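/- Let $K\subset\mathbb R^2$ be a compact strictly convex set bounded by a curve $\Gamma=\partial K$ of class $\mathcal C^2$; that is, its support function $p(\varphi)=\sup_{x\in K}\langle x,N(\varphi)\rangle$, $N(\varphi)=(\cos\varphi,\sin\varphi)$, is of class $\mathcal C^2$ and $p+p''>0$. Let $F$ be the area of $K$, $L$ the length of $\Gamma$, $\Delta=L^2-4\pi F$, and let $F_e$ be the area with multiplicities enclosed by the evolute of $\Gamma$. For $P\notin K$ let $\omega=\omega(P)$ be the visual angle of $\Gamma$ from $P$, i.e. the angle between the two tangents from $P$ to $\Gamma$, and let $dP$ be the area measure. Here the curve with generalized support function $f$ is the envelope $t\mapsto f(t)N(t)+f'(t)N'(t)$ of the lines $x\cos t+y\sin t=f(t)$; the area with multiplicities that it encloses, for $f$ of class $\mathcal C^1$ and $2\pi$-periodic, is $\frac12\int_0^{2\pi}(f^2-f'^2)\,dt$ (which is $\frac12\int_0^{2\pi} f(f+f'')\,dt$ if $f$ is $\mathcal C^2$), and the evolute of $\Gamma$ has generalized support function $p'(\varphi-\pi/2)$. A curve parallel to the curve with generalized support function $f$ is one with generalized support function $f+d$, $d\in\mathbb R$.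 Astroids and Steiner curves (deltoids) are the hypocycloids with four and three cusps, of any size and in any position. Then the function $\omega-\sin\omega-\frac23\sin^3\omega$ is integrable over $\mathbb R^2\setminus K$, and the following are equivalent. (1) $$\pi|F_e|-\Delta=\frac54L^2+5\int_{P\notin K}\Bigl(\omega-\sin\omega-\frac23\sin^3\omega\Bigr)\,dP .$$ (2) One of the following holds: a) $K$ is a disk or is bounded by a curve parallel to an astroid; b) $K$ is bounded by a curve parallel to a Steiner curve; c) $K$ is the Minkowski sum of finitely many (at least two) domains of the above types. Here the summands need not be convex: a summand is a disk, or the domain of a curve parallel to an astroid or to a Steiner curve, it is given by its generalized support function, and $K$ being the Minkowski sum means that the support function of $K$ is the sum of the generalized support functions of the summands (for convex summands this is the usual Minkowski sum). (3) The support function of $K$ with respect to its Steiner point $s(K)=\frac1\pi\int_0^{2\pi}p(\varphi)N(\varphi)\,d\varphi$ as origin has the form $$a_0+a_2\cos2\varphi+b_2\sin2\varphi+a_3\cos3\varphi+b_3\sin3\varphi$$ with real constants $a_0,a_2,b_2,a_3,b_3$. -/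

import Mathlib

open MeasureTheory Set
open scoped Real Pointwise

noncomputable section

namespace VisualAngleDeficit

/-- The Euclidean plane. -/
abbrev Plane : Type := EuclideanSpace ℝ (Fin 2)

/-- The unit vector `N(φ) = (cos φ, sin φ)`. -/
def normalVec (φ : ℝ) : Plane := !₂[Real.cos φ, Real.sin φ]

/-- Its derivative `N'(φ) = (-sin φ, cos φ)`. -/
def tangentVec (φ : ℝ) : Plane := !₂[-Real.sin φ, Real.cos φ]

/-- The support function `p(φ) = sup {⟨x, N(φ)⟩ : x ∈ K}` of `K` with respect to the origin. -/
def supportFn (K : Set Plane) (φ : ℝ) : ℝ :=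
  sSup ((fun x : Plane => inner ℝ x (normalVec φ)) '' K)

/-- A compact strictly convex set bounded by a curve of class `C²`: the support function is `C²` and
the radius of curvature `p + p''` is everywhere positive. -/
structure IsStrictlyConvexC2 (K : Set Plane) : Prop where
  nonempty : K.Nonempty
  isCompact : IsCompact K
  convex : Convex ℝ K
  contDiff : ContDiff ℝ 2 (supportFn K)
  curvature_pos : ∀ φ : ℝ, 0 < supportFn K φ + deriv (deriv (supportFn K)) φ

/-- The envelope of the family of lines `x cos t + y sin t = f(t)`, i.e. the curve with generalized
support function `f`: the point with parameter `t` is `f(t) N(t) + f'(t) N'(t)`. For `f` the support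
function of a strictly convex `K` this parametrizes the boundary of `K` by its outer normal. -/
def envelope (f : ℝ → ℝ) (t : ℝ) : Plane :=
  f t • normalVec t + deriv f t • tangentVec t

/-- The length of the boundary of `K`, as the arc length of its parametrization by the normal. -/
def boundaryLength (K : Set Plane) : ℝ :=
  ∫ φ in (0 : ℝ)..(2 * π), ‖deriv (envelope (supportFn K)) φ‖

/-- The area of `K`. -/
def area (K : Set Plane) : ℝ := (volume K).toReal

/-- The area with multiplicities swept by the radius vector of the closed curve with the
`2π`-periodic generalized support function `f`. It is `½ ∮ (x dy - y dx) = ½ ∫ f (f + f'')`,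
integrated by parts so that it makes sense for every `f` of class `C¹`;
see `sweptArea_eq_line_integral` and `sweptArea_eq`. -/
def sweptArea (f : ℝ → ℝ) : ℝ :=
  (1 / 2) * ∫ t in (0 : ℝ)..(2 * π), (f t ^ 2 - deriv f t ^ 2)

/-- The evolute (the locus of the centres of curvature) of the boundary of `K`. -/
def evolute (K : Set Plane) (φ : ℝ) : Plane :=
  envelope (supportFn K) φ -
    (supportFn K φ + deriv (deriv (supportFn K)) φ) • normalVec φ

/-- The generalized support function `p'(φ - π/2)` of the evolute;
see `envelope_evoluteSupport`. -/
def evoluteSupport (K : Set Plane) (φ : ℝ) : ℝ := deriv (supportFn K) (φ - π / 2)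

/-- The area with multiplicities enclosed by the evolute of the boundary of `K`. -/
def evoluteArea (K : Set Plane) : ℝ := sweptArea (evoluteSupport K)

/-- The point `x` of `K` is a point of contact of a tangent (support) line of `K` through `P`. -/
def IsTangencyPoint (K : Set Plane) (P x : Plane) : Prop :=
  x ∈ K ∧ ∃ u : Plane, u ≠ 0 ∧ inner ℝ u P = inner ℝ u x ∧ ∀ y ∈ K, inner ℝ u y ≤ inner ℝ u x

/-- The visual angle of `K` from an exterior point `P`: the angle at `P` between the tangents from
`P` to `K`. For a strictly convex `K` there are two points of contact `x ≠ y`, and the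
supremum is the angle `x P y`; the pairs `x = y` only contribute the value `0`. -/
def visualAngle (K : Set Plane) (P : Plane) : ℝ :=
  sSup {θ : ℝ | ∃ x y : Plane, IsTangencyPoint K P x ∧ IsTangencyPoint K P y ∧
    θ = EuclideanGeometry.angle x P y}

/-- The integrand `ω - sin ω - (2/3) sin³ ω`, where `ω` is the visual angle of `K` from `P`. -/
def visualIntegrand (K : Set Plane) (P : Plane) : ℝ :=
  visualAngle K P - Real.sin (visualAngle K P) - (2 / 3) * Real.sin (visualAngle K P) ^ 3

/-- Equality `π|F_e| - Δ = (5/4) L² + 5 ∫_{P ∉ K} (ω - sin ω - (2/3) sin³ ω) dP`, where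
`Δ = L² - 4πF`. -/
def EqualityHolds (K : Set Plane) : Prop :=
  π * |evoluteArea K| - (boundaryLength K ^ 2 - 4 * π * area K) =
    (5 / 4) * boundaryLength K ^ 2 + 5 * ∫ P in Kᶜ, visualIntegrand K P

/-- The hypocycloid traced by rolling a circle of radius `r` inside a circle of radius `k r`
centred at the origin. -/
def hypocycloid (k r t : ℝ) : Plane :=
  !₂[r * (k - 1) * Real.sin t - r * Real.sin ((k - 1) * t),
     r * (k - 1) * Real.cos t + r * Real.cos ((k - 1) * t)]

/-- Rotation of the plane about the origin by the angle `α`. -/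
def rotate (α : ℝ) (v : Plane) : Plane := v 0 • normalVec α + v 1 • tangentVec α

/-- `f` is a generalized support function of a hypocycloid of ratio `k`, in any position (centre `c`,
rotated by `α`) and of any size `r > 0`. The normal of the unrotated hypocycloid at the parameter
`t` has the angle `(k - 2) t / 2`. -/
def IsHypocycloidSupport (k : ℝ) (f : ℝ → ℝ) : Prop :=
  ∃ (r : ℝ) (c : Plane) (α : ℝ), 0 < r ∧
    ∀ t : ℝ, envelope f (α + (k - 2) / 2 * t) = c + rotate α (hypocycloid k r t)

/-- `f` is a generalized support function of a curve parallel to an astroid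
(at some signed distance `d`). -/
def IsAstroidParallel (f : ℝ → ℝ) : Prop :=
  ∃ (g : ℝ → ℝ) (d : ℝ), IsHypocycloidSupport 4 g ∧ ∀ t : ℝ, f t = g t + d

/-- `f` is a generalized support function of a curve parallel to a Steiner curve (deltoid)
(at some signed distance `d`). -/
def IsDeltoidParallel (f : ℝ → ℝ) : Prop :=
  ∃ (g : ℝ → ℝ) (d : ℝ), IsHypocycloidSupport 3 g ∧ ∀ t : ℝ, f t = g t + d

/-- `f` is the support function of a disk. -/
def IsDiskSupport (f : ℝ → ℝ) : Prop :=
  ∃ (c : Plane) (r : ℝ), 0 < r ∧ ∀ t : ℝ, f t = supportFn (Metric.closedBall c r) t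

/-- `K` is bounded by the curve with generalized support function `f`. -/
def IsBoundedBy (K : Set Plane) (f : ℝ → ℝ) : Prop :=
  frontier K = Set.range (envelope f)

/-- `K` is a disk or is bounded by a curve parallel to an astroid. -/
def IsDiskOrAstroidType (K : Set Plane) : Prop :=
  (∃ (c : Plane) (r : ℝ), 0 < r ∧ K = Metric.closedBall c r) ∨
    ∃ f : ℝ → ℝ, IsAstroidParallel f ∧ IsBoundedBy K f

/-- `K` is bounded by a curve parallel to a Steiner curve. -/
def IsDeltoidType (K : Set Plane) : Prop :=
  ∃ f : ℝ → ℝ, IsDeltoidParallel f ∧ IsBoundedBy K f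

/-- `K` is the Minkowski sum of finitely many (at least two) domains, each a disk or bounded by a
curve parallel to an astroid or to a Steiner curve. The summands need not be convex: they are given
by their generalized support functions, and the Minkowski sum is the set whose support function is
the sum of these. For convex summands this is the usual Minkowski sum; see `supportFn_add`. -/
def IsMinkowskiSumType (K : Set Plane) : Prop :=
  ∃ (n : ℕ) (f : Fin n → ℝ → ℝ), 2 ≤ n ∧
    (∀ i, IsDiskSupport (f i) ∨ IsAstroidParallel (f i) ∨ IsDeltoidParallel (f i)) ∧
    ∀ φ : ℝ, supportFn K φ = ∑ i, f i φ

/-- The Steiner point `s(K) = (1/π) ∫₀^{2π} p(φ) N(φ) dφ`. -/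
def steinerPoint (K : Set Plane) : Plane :=
  (1 / π) • ∫ φ in (0 : ℝ)..(2 * π), supportFn K φ • normalVec φ

/-- The support function of `K` with respect to its Steiner point as origin. -/
def steinerSupportFn (K : Set Plane) : ℝ → ℝ :=
  supportFn ((fun x => x - steinerPoint K) '' K)

/-- The support function of `K` about the Steiner point has only Fourier modes `0`, `2`, `3`. -/
def HasOnlyModesZeroTwoThree (K : Set Plane) : Prop :=
  ∃ a₀ a₂ b₂ a₃ b₃ : ℝ, ∀ φ : ℝ, steinerSupportFn K φ =
    a₀ + a₂ * Real.cos (2 * φ) + b₂ * Real.sin (2 * φ)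
      + a₃ * Real.cos (3 * φ) + b₃ * Real.sin (3 * φ)

/-! Facts that confirm the readings above. -/

/-- The evolute is the curve with generalized support function `p'(φ - π/2)`. -/
theorem envelope_evoluteSupport (K : Set Plane) (φ : ℝ) :
    envelope (evoluteSupport K) (φ + π / 2) = evolute K φ := by
  have h : deriv (evoluteSupport K) (φ + π / 2) = deriv (deriv (supportFn K)) φ := by
    unfold evoluteSupport
    rw [deriv_comp_sub_const]
    simp
  unfold evolute envelope
  rw [h]
  ext i
  fin_cases i <;>
    simp [evoluteSupport, normalVec, tangentVec, Real.cos_add_pi_div_two,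
      Real.sin_add_pi_div_two] <;> ring

/-- For `f` of class `C²` the swept area is `½ ∫ f (f + f'')`. -/
theorem sweptArea_eq (f : ℝ → ℝ) (hf : ContDiff ℝ 2 f) (hp : Function.Periodic f (2 * π)) :
    sweptArea f = (1 / 2) * ∫ t in (0 : ℝ)..(2 * π), f t * (f t + deriv (deriv f) t) := by
  have h1 : ContDiff ℝ 1 (deriv f) := by
    have h2 : ContDiff ℝ (1 + 1) f := by simpa [one_add_one_eq_two] using hf
    exact (contDiff_succ_iff_deriv.1 h2).2.2
  have hc2 : Continuous (deriv (deriv f)) := h1.continuous_deriv le_rfl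
  have hc1 : Continuous (deriv f) := h1.continuous
  have hc0 : Continuous f := hf.continuous
  have hd : Differentiable ℝ f := hf.differentiable (by norm_num)
  have hd1 : Differentiable ℝ (deriv f) := h1.differentiable (by norm_num)
  have hp0 : f (2 * π) = f 0 := by simpa using hp 0
  have hp1 : deriv f (2 * π) = deriv f 0 := by
    have h3 : (fun x => f (x + 2 * π)) = f := funext hp
    have h4 := deriv_comp_add_const f (2 * π) 0
    rw [h3] at h4
    simpa using h4.symm
  have hparts := intervalIntegral.integral_mul_deriv_eq_deriv_mul (a := 0) (b := 2 * π)
    (u := f) (v := deriv f) (u' := deriv f) (v' := deriv (deriv f))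
    (fun x _ => (hd x).hasDerivAt) (fun x _ => (hd1 x).hasDerivAt)
    (hc1.intervalIntegrable _ _) (hc2.intervalIntegrable _ _)
  rw [hp0, hp1, sub_self, zero_sub] at hparts
  unfold sweptArea
  congr 1
  have e1 : (∫ t in (0 : ℝ)..(2 * π), (f t ^ 2 - deriv f t ^ 2)) =
      (∫ t in (0 : ℝ)..(2 * π), f t ^ 2) - ∫ t in (0 : ℝ)..(2 * π), deriv f t * deriv f t := by
    rw [← intervalIntegral.integral_sub]
    · simp [sq]
    · exact (hc0.pow 2).intervalIntegrable _ _
    · exact (hc1.mul hc1).intervalIntegrable _ _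
  have e2 : (∫ t in (0 : ℝ)..(2 * π), f t * (f t + deriv (deriv f) t)) =
      (∫ t in (0 : ℝ)..(2 * π), f t ^ 2) +
        ∫ t in (0 : ℝ)..(2 * π), f t * deriv (deriv f) t := by
    rw [← intervalIntegral.integral_add]
    · simp [sq, mul_add]
    · exact (hc0.pow 2).intervalIntegrable _ _
    · exact (hc0.mul hc2).intervalIntegrable _ _
  rw [e1, e2, hparts]
  ring

/-- For `f` of class `C²` the swept area is the line integral `½ ∮ (x dy - y dx)`. -/
theorem sweptArea_eq_line_integral (f : ℝ → ℝ) (hf : ContDiff ℝ 2 f)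
    (hp : Function.Periodic f (2 * π)) :
    sweptArea f = (1 / 2) * ∫ t in (0 : ℝ)..(2 * π),
      (envelope f t 0 * deriv (fun s => envelope f s 1) t
        - envelope f t 1 * deriv (fun s => envelope f s 0) t) := by
  rw [sweptArea_eq f hf hp]
  have h1 : ContDiff ℝ 1 (deriv f) := by
    have h2 : ContDiff ℝ (1 + 1) f := by simpa [one_add_one_eq_two] using hf
    exact (contDiff_succ_iff_deriv.1 h2).2.2
  have hd : Differentiable ℝ f := hf.differentiable (by norm_num)
  have hd1 : Differentiable ℝ (deriv f) := h1.differentiable (by norm_num)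
  congr 1
  apply intervalIntegral.integral_congr
  intro t _
  have hx : deriv (fun s => envelope f s 0) t = -(f t + deriv (deriv f) t) * Real.sin t := by
    have h := ((hd t).hasDerivAt.mul (Real.hasDerivAt_cos t)).add
      ((hd1 t).hasDerivAt.mul (Real.hasDerivAt_sin t).neg)
    have e : (fun s => envelope f s 0) = (f * Real.cos + deriv f * -Real.sin) := by
      funext s
      simp [envelope, normalVec, tangentVec]
    rw [e, h.deriv]
    simp
    ring
  have hy : deriv (fun s => envelope f s 1) t = (f t + deriv (deriv f) t) * Real.cos t := by
    have h := ((hd t).hasDerivAt.mul (Real.hasDerivAt_sin t)).add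
      ((hd1 t).hasDerivAt.mul (Real.hasDerivAt_cos t))
    have e : (fun s => envelope f s 1) = (f * Real.sin + deriv f * Real.cos) := by
      funext s
      simp [envelope, normalVec, tangentVec]
    rw [e, h.deriv]
    simp
    ring
  simp only [hx, hy]
  simp [envelope, normalVec, tangentVec]
  linear_combination (-(f t * (f t + deriv (deriv f) t))) * Real.sin_sq_add_cos_sq t

/-- Support functions are additive under Minkowski addition. -/
theorem supportFn_add (A B : Set Plane) (hA : IsCompact A) (hB : IsCompact B)
    (hA' : A.Nonempty) (hB' : B.Nonempty) (φ : ℝ) :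
    supportFn (A + B) φ = supportFn A φ + supportFn B φ := by
  have hc : Continuous (fun x : Plane => (inner ℝ x (normalVec φ) : ℝ)) := by fun_prop
  unfold supportFn
  rw [← csSup_add (hA'.image _) (hA.image hc).bddAbove (hB'.image _) (hB.image hc).bddAbove]
  congr 1
  ext z
  constructor
  · rintro ⟨_, ⟨a, ha, b, hb, rfl⟩, rfl⟩
    exact ⟨_, ⟨a, ha, rfl⟩, _, ⟨b, hb, rfl⟩, (inner_add_left _ _ _).symm⟩
  · rintro ⟨_, ⟨a, ha, rfl⟩, _, ⟨b, hb, rfl⟩, rfl⟩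
    exact ⟨_, ⟨a, ha, b, hb, rfl⟩, inner_add_left _ _ _⟩

end VisualAngleDeficit

end

/-!
Let `p` be the support function of `K`. A point outside `K` is the intersection of two tangents,
with normal angles `φ` and `φ + δ`, and sees `K` under the angle `π - δ`. In the coordinates
`(δ, φ)` the area element is `t₁ t₂ / sin δ`, where `t₁`, `t₂` are the lengths of the two
tangents, so the integral of the visual angle function is an integral over `0 < δ < π` of
autocorrelations of `p` and `p'`. Integrating by parts twice in `δ` leaves a multiple of the
squared second harmonic of `p`, from the weight `cos 2δ`, and a multiple of `∫ (p² - p'²)`. By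
Parseval the two sides of (1) therefore differ by a positive multiple of `∑ w n * |c n|²`, where
`c n` are the Fourier coefficients of `p` and `w n = (n² - 1) (n² - 9)` for `|n| ≥ 4`, `w n = 0`
otherwise. Hence (1) holds if and only if `p` has no harmonics of order four or more, which is
(3), since the first harmonic is removed by moving the origin to the Steiner point.

The support function of a hypocycloid of ratio `k` is, about its centre, a pure harmonic of
frequency `k / (k - 2)`, so astroids are the second harmonics and Steiner curves the third ones.
Conversely, if `K` is bounded by a parallel of such a curve, each point of `∂K` with outer normal
`N` is, up to countably many exceptions, a regular point of the curve with normal `±N`; so the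
support function of `K` agrees at each angle with that of the curve or with that of the same curve
with reversed normals. Since `p + p'' > 0` these two cannot cross unless they coincide, so by
continuity one of the two alternatives holds throughout.
-/

namespace VisualAngleDeficit

/-! ### Generalized support functions with positive radius of curvature -/

/-- A generalized support function `p` of class `C²` whose envelope has positive radius of
curvature `p + p''`. Subtracting the support function `⟨P, N⟩` of a point does not change `p + p''`,
so this class is stable under a change of origin. -/
structure PositivelyCurved (p : ℝ → ℝ) : Prop where
  contDiff : ContDiff ℝ 2 p
  curvature_pos : ∀ φ : ℝ, 0 < p φ + deriv (deriv p) φ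

section SecondDerivative

variable {p : ℝ → ℝ} (hp : ContDiff ℝ 2 p)
include hp

theorem hasDerivAt_of_contDiff_two (φ : ℝ) : HasDerivAt p (deriv p φ) φ :=
  (hp.differentiable two_ne_zero φ).hasDerivAt

theorem contDiff_deriv_of_contDiff_two : ContDiff ℝ 1 (deriv p) :=
  ContDiff.deriv' (by rwa [one_add_one_eq_two])

theorem hasDerivAt_deriv_of_contDiff_two (φ : ℝ) :
    HasDerivAt (deriv p) (deriv (deriv p) φ) φ :=
  (hp.differentiable_deriv_two φ).hasDerivAt

theorem continuous_deriv_deriv_of_contDiff_two : Continuous (deriv (deriv p)) :=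
  (contDiff_deriv_of_contDiff_two hp).continuous_deriv_one

theorem continuous_curvature_mul_sin (x : ℝ) :
    Continuous fun τ => (p τ + deriv (deriv p) τ) * Real.sin (x - τ) := by
  have := hp.continuous
  have := continuous_deriv_deriv_of_contDiff_two hp
  fun_prop

theorem eq_add_integral_curvature_mul_sin (a x : ℝ) :
    p x = p a * Real.cos (x - a) + deriv p a * Real.sin (x - a) +
      ∫ τ in a..x, (p τ + deriv (deriv p) τ) * Real.sin (x - τ) := by
  have hderiv (τ : ℝ) : HasDerivAt (fun t => deriv p t * Real.sin (x - t) + p t * Real.cos (x - t))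
      ((p τ + deriv (deriv p) τ) * Real.sin (x - τ)) τ := by
    have hsub := (hasDerivAt_id' τ).const_sub x
    exact (((hasDerivAt_deriv_of_contDiff_two hp τ).mul hsub.sin).add
      ((hasDerivAt_of_contDiff_two hp τ).mul hsub.cos)).congr_deriv (by ring)
  rw [intervalIntegral.integral_eq_sub_of_hasDerivAt (fun τ _ => hderiv τ)
    ((continuous_curvature_mul_sin hp x).intervalIntegrable a x)]
  simp only [sub_self, Real.sin_zero, mul_zero, Real.cos_zero, mul_one, zero_add]
  ring

end SecondDerivative

theorem deriv_periodic {f : ℝ → ℝ} {c : ℝ} (hf : Function.Periodic f c) :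
    Function.Periodic (deriv f) c := by
  intro x
  rw [← deriv_comp_add_const, funext hf]

namespace PositivelyCurved

variable {p : ℝ → ℝ} (hp : PositivelyCurved p)
include hp

theorem cos_add_sin_lt {a x : ℝ} (hne : x ≠ a) (hx : |x - a| ≤ π) :
    p a * Real.cos (x - a) + deriv p a * Real.sin (x - a) < p x := by
  obtain ⟨hleft, hright⟩ := abs_le.1 hx
  rw [eq_add_integral_curvature_mul_sin hp.contDiff a x, lt_add_iff_pos_right]
  rcases hne.lt_or_gt with hlt | hlt
  · rw [intervalIntegral.integral_symm, ← intervalIntegral.integral_neg]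
    refine intervalIntegral.intervalIntegral_pos_of_pos_on
      ((continuous_curvature_mul_sin hp.contDiff x).neg.intervalIntegrable x a)
      (fun τ hτ => neg_pos.2 (mul_neg_of_pos_of_neg (hp.curvature_pos τ) ?_)) hlt
    exact Real.sin_neg_of_neg_of_neg_pi_lt (by linarith [hτ.1]) (by linarith [hτ.2])
  · refine intervalIntegral.intervalIntegral_pos_of_pos_on
      ((continuous_curvature_mul_sin hp.contDiff x).intervalIntegrable a x)
      (fun τ hτ => mul_pos (hp.curvature_pos τ) ?_) hlt
    exact Real.sin_pos_of_pos_of_lt_pi (by linarith [hτ.2]) (by linarith [hτ.1])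

theorem add_apply_add_pi_pos (x : ℝ) : 0 < p x + p (x + π) := by
  have h := hp.cos_add_sin_lt (a := x) (x := x + π) (by simp [Real.pi_ne_zero])
    (by simp [abs_of_pos Real.pi_pos])
  simp only [add_sub_cancel_left, Real.cos_pi, Real.sin_pi] at h
  linarith

theorem deriv_neg_of_zeros {a b : ℝ} (ha : p a = 0) (hb : p b = 0) (hab : a < b)
    (hba : b < a + π) : deriv p a < 0 := by
  have h := hp.cos_add_sin_lt hab.ne' (abs_le.2 ⟨by linarith, by linarith⟩)
  have hsin : 0 < Real.sin (b - a) := Real.sin_pos_of_pos_of_lt_pi (by linarith) (by linarith)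
  rw [ha, hb] at h
  nlinarith

theorem deriv_pos_of_zeros {a b : ℝ} (ha : p a = 0) (hb : p b = 0) (hab : a < b)
    (hba : b < a + π) : 0 < deriv p b := by
  have h := hp.cos_add_sin_lt hab.ne (abs_le.2 ⟨by linarith, by linarith⟩)
  have hsin : Real.sin (a - b) < 0 :=
    Real.sin_neg_of_neg_of_neg_pi_lt (by linarith) (by linarith)
  rw [ha, hb] at h
  nlinarith

theorem pos_left_of_zero {a x : ℝ} (ha : p a = 0) (ha' : deriv p a ≤ 0) (hx : x < a)
    (hx' : a - π ≤ x) : 0 < p x := by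
  have h := hp.cos_add_sin_lt hx.ne (abs_le.2 ⟨by linarith, by linarith⟩)
  have hsin : Real.sin (x - a) ≤ 0 :=
    Real.sin_nonpos_of_nonpos_of_neg_pi_le (by linarith) (by linarith)
  rw [ha] at h
  nlinarith

theorem pos_right_of_zero {a x : ℝ} (ha : p a = 0) (ha' : 0 ≤ deriv p a) (hx : a < x)
    (hx' : x ≤ a + π) : 0 < p x := by
  have h := hp.cos_add_sin_lt hx.ne' (abs_le.2 ⟨by linarith, by linarith⟩)
  have hsin : 0 ≤ Real.sin (x - a) :=
    Real.sin_nonneg_of_nonneg_of_le_pi (by linarith) (by linarith)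
  rw [ha] at h
  nlinarith

theorem ne_zero_of_mem_Ioo_zeros {a b x : ℝ} (ha : p a = 0) (hb : p b = 0)
    (hba : b < a + π) (hx : x ∈ Ioo a b) : p x ≠ 0 := by
  intro h0
  rcases le_total (deriv p x) 0 with hderiv | hderiv
  · linarith [hp.pos_left_of_zero h0 hderiv hx.1 (by linarith [hx.2])]
  · linarith [hp.pos_right_of_zero h0 hderiv hx.2 (by linarith [hx.1])]

variable (hper : Function.Periodic p (2 * π))
include hper

theorem pos_of_double_zero {a x : ℝ} (ha : p a = 0) (ha' : deriv p a = 0)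
    (hx : x ∈ Ioo a (a + 2 * π)) : 0 < p x := by
  rcases le_total x (a + π) with h | h
  · exact hp.pos_right_of_zero ha ha'.ge hx.1 h
  · rw [← hper.sub_eq]
    exact hp.pos_left_of_zero ha ha'.le (by linarith [hx.2]) (by linarith)

theorem eq_or_eq_of_zeros {a b x : ℝ} (ha : p a = 0) (hb : p b = 0) (hab : a < b)
    (hba : b < a + π) (hx : x ∈ Ico a (a + 2 * π)) (h0 : p x = 0) : x = a ∨ x = b := by
  by_contra! hne
  rcases lt_or_gt_of_ne hne.2 with hlt | hlt
  · exact hp.ne_zero_of_mem_Ioo_zeros ha hb hba ⟨lt_of_le_of_ne hx.1 hne.1.symm, hlt⟩ h0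
  · rcases le_total x (b + π) with h | h
    · linarith [hp.pos_right_of_zero hb (hp.deriv_pos_of_zeros ha hb hab hba).le hlt h]
    · have hpos := hp.pos_left_of_zero ha (hp.deriv_neg_of_zeros ha hb hab hba).le
        (x := x - 2 * π) (by linarith [hx.2]) (by linarith)
      rw [hper.sub_eq] at hpos
      linarith

theorem exists_zeros_around_of_neg {c : ℝ} (hc : p c < 0) :
    ∃ a ∈ Ioo (c - π) c, ∃ b ∈ Ioo c (c + π), p a = 0 ∧ p b = 0 := by
  have hright : 0 < p (c + π) := by linarith [hp.add_apply_add_pi_pos c]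
  have hleft : 0 < p (c - π) := by
    rwa [← hper, show c - π + 2 * π = c + π by ring]
  have hcont := hp.contDiff.continuous.continuousOn (s := univ)
  obtain ⟨a, ha, ha0⟩ := intermediate_value_Ioo' (by linarith [Real.pi_pos])
    (hcont.mono (subset_univ (Icc (c - π) c))) ⟨hc, hleft⟩
  obtain ⟨b, hb, hb0⟩ := intermediate_value_Ioo (by linarith [Real.pi_pos])
    (hcont.mono (subset_univ (Icc c (c + π)))) ⟨hc, hright⟩
  exact ⟨a, ha, b, hb, ha0, hb0⟩

theorem exists_zeros_of_neg {c : ℝ} (hc : p c < 0) :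
    ∃ a b, a < b ∧ b < a + π ∧ p a = 0 ∧ p b = 0 := by
  obtain ⟨a, ha, b, hb, ha0, hb0⟩ := hp.exists_zeros_around_of_neg hper hc
  have hderiv : deriv p a < 0 := by
    by_contra! hnonneg
    linarith [hp.pos_right_of_zero ha0 hnonneg ha.2 (by linarith [ha.1])]
  refine ⟨a, b, ha.2.trans hb.1, ?_, ha0, hb0⟩
  by_contra! hle
  rcases hle.eq_or_lt with heq | hlt
  · have hpos := hp.add_apply_add_pi_pos a
    rw [heq, ha0, hb0] at hpos
    linarith
  · have hpos := hp.pos_left_of_zero ha0 hderiv.le (x := b - 2 * π) (by linarith [ha.1, hb.2])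
      (by linarith)
    rw [hper.sub_eq] at hpos
    linarith

end PositivelyCurved

/-! ### Support functions in the plane -/

theorem inner_normalVec (x : Plane) (φ : ℝ) :
    inner ℝ x (normalVec φ) = x 0 * Real.cos φ + x 1 * Real.sin φ := by
  simp [normalVec, PiLp.inner_apply, Fin.sum_univ_two, mul_comm]

theorem inner_tangentVec (x : Plane) (φ : ℝ) :
    inner ℝ x (tangentVec φ) = -x 0 * Real.sin φ + x 1 * Real.cos φ := by
  simp [tangentVec, PiLp.inner_apply, Fin.sum_univ_two, mul_comm]

theorem norm_normalVec (φ : ℝ) : ‖normalVec φ‖ = 1 := by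
  simp [EuclideanSpace.norm_eq, normalVec, Fin.sum_univ_two]

theorem norm_tangentVec (φ : ℝ) : ‖tangentVec φ‖ = 1 := by
  simp [EuclideanSpace.norm_eq, tangentVec, Fin.sum_univ_two]

theorem inner_tangentVec_normalVec (φ ψ : ℝ) :
    inner ℝ (tangentVec φ) (normalVec ψ) = Real.sin (ψ - φ) := by
  rw [inner_normalVec, Real.sin_sub]
  simp only [tangentVec, Matrix.cons_val_zero, Matrix.cons_val_one]
  ring

theorem inner_tangentVec_tangentVec (φ ψ : ℝ) :
    inner ℝ (tangentVec φ) (tangentVec ψ) = Real.cos (ψ - φ) := by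
  rw [inner_tangentVec, Real.cos_sub]
  simp only [tangentVec, Matrix.cons_val_zero, Matrix.cons_val_one]
  ring

theorem normalVec_periodic : Function.Periodic normalVec (2 * π) := by
  intro φ
  simp [normalVec]

theorem tangentVec_periodic : Function.Periodic tangentVec (2 * π) := by
  intro φ
  simp [tangentVec]

theorem hasDerivAt_inner_normalVec (x : Plane) (φ : ℝ) :
    HasDerivAt (fun t => inner ℝ x (normalVec t)) (inner ℝ x (tangentVec φ)) φ := by
  simp only [inner_normalVec, inner_tangentVec]
  exact (((Real.hasDerivAt_cos φ).const_mul (x 0)).add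
    ((Real.hasDerivAt_sin φ).const_mul (x 1))).congr_deriv (by ring)

theorem hasDerivAt_inner_tangentVec (x : Plane) (φ : ℝ) :
    HasDerivAt (fun t => inner ℝ x (tangentVec t)) (-inner ℝ x (normalVec φ)) φ := by
  simp only [inner_normalVec, inner_tangentVec]
  exact (((Real.hasDerivAt_sin φ).const_mul (-x 0)).add
    ((Real.hasDerivAt_cos φ).const_mul (x 1))).congr_deriv (by ring)

theorem contDiff_inner_normalVec (x : Plane) (n : ℕ∞) :
    ContDiff ℝ n fun t => inner ℝ x (normalVec t) := by
  simp only [inner_normalVec]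
  fun_prop

theorem plane_ext_of_inner {x y : Plane} (φ : ℝ)
    (hnormal : inner ℝ x (normalVec φ) = inner ℝ y (normalVec φ))
    (htangent : inner ℝ x (tangentVec φ) = inner ℝ y (tangentVec φ)) : x = y := by
  rw [inner_normalVec, inner_normalVec] at hnormal
  rw [inner_tangentVec, inner_tangentVec] at htangent
  have hsq := Real.sin_sq_add_cos_sq φ
  have h0 : x 0 = y 0 := by
    linear_combination Real.cos φ * hnormal - Real.sin φ * htangent + (y 0 - x 0) * hsq
  have h1 : x 1 = y 1 := by
    linear_combination Real.sin φ * hnormal + Real.cos φ * htangent + (y 1 - x 1) * hsq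
  ext i
  fin_cases i
  exacts [h0, h1]

theorem exists_eq_norm_smul_normalVec (u : Plane) : ∃ φ : ℝ, u = ‖u‖ • normalVec φ := by
  refine ⟨Complex.arg ⟨u 0, u 1⟩, ?_⟩
  have hnorm : ‖u‖ = ‖(⟨u 0, u 1⟩ : ℂ)‖ := by
    rw [EuclideanSpace.norm_eq, Complex.norm_def, Complex.normSq_apply]
    simp [Fin.sum_univ_two, sq]
  ext i
  fin_cases i
  · simp [normalVec, hnorm, Complex.norm_mul_cos_arg]
  · simp [normalVec, hnorm, Complex.norm_mul_sin_arg]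

theorem inner_envelope_normalVec (f : ℝ → ℝ) (t φ : ℝ) :
    inner ℝ (envelope f t) (normalVec φ) =
      f t * Real.cos (φ - t) + deriv f t * Real.sin (φ - t) := by
  rw [inner_normalVec, Real.cos_sub, Real.sin_sub]
  simp only [envelope, normalVec, tangentVec, PiLp.add_apply, PiLp.smul_apply, smul_eq_mul,
    Matrix.cons_val_zero, Matrix.cons_val_one, Matrix.cons_val_fin_one]
  ring

theorem inner_envelope_tangentVec (f : ℝ → ℝ) (t φ : ℝ) :
    inner ℝ (envelope f t) (tangentVec φ) =
      deriv f t * Real.cos (φ - t) - f t * Real.sin (φ - t) := by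
  rw [inner_tangentVec, Real.cos_sub, Real.sin_sub]
  simp only [envelope, normalVec, tangentVec, PiLp.add_apply, PiLp.smul_apply, smul_eq_mul,
    Matrix.cons_val_zero, Matrix.cons_val_one, Matrix.cons_val_fin_one]
  ring

theorem inner_envelope_normalVec_self (f : ℝ → ℝ) (φ : ℝ) :
    inner ℝ (envelope f φ) (normalVec φ) = f φ := by
  simp [inner_envelope_normalVec]

theorem envelope_periodic {f : ℝ → ℝ} (hf : Function.Periodic f (2 * π)) :
    Function.Periodic (envelope f) (2 * π) := by
  intro x
  simp only [envelope, hf x, deriv_periodic hf x, normalVec_periodic x, tangentVec_periodic x]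

theorem supportFn_periodic (K : Set Plane) : Function.Periodic (supportFn K) (2 * π) := by
  intro φ
  simp only [supportFn, normalVec_periodic φ]

section SupportFn

variable {K : Set Plane} (hK : IsCompact K)
include hK

theorem isCompact_image_inner_normalVec (φ : ℝ) :
    IsCompact ((fun x : Plane => (inner ℝ x (normalVec φ) : ℝ)) '' K) :=
  hK.image (by fun_prop)

theorem inner_le_supportFn {x : Plane} (hx : x ∈ K) (φ : ℝ) :
    inner ℝ x (normalVec φ) ≤ supportFn K φ :=
  le_csSup (isCompact_image_inner_normalVec hK φ).bddAbove ⟨x, hx, rfl⟩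

theorem exists_inner_eq_supportFn (hne : K.Nonempty) (φ : ℝ) :
    ∃ x ∈ K, inner ℝ x (normalVec φ) = supportFn K φ :=
  (isCompact_image_inner_normalVec hK φ).sSup_mem (hne.image _)

theorem mem_of_forall_inner_le (hc : Convex ℝ K) (hne : K.Nonempty) {x : Plane}
    (h : ∀ φ, inner ℝ x (normalVec φ) ≤ supportFn K φ) : x ∈ K := by
  by_contra hx
  obtain ⟨l, c, hlx, hlK⟩ := geometric_hahn_banach_point_closed hc hK.isClosed hx
  set u := -(InnerProductSpace.toDual ℝ Plane).symm l with hu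
  obtain ⟨φ, hφ⟩ := exists_eq_norm_smul_normalVec u
  have hl (z : Plane) : l z = -(‖u‖ * inner ℝ z (normalVec φ)) := by
    rw [← inner_smul_right, ← hφ, hu, inner_neg_right, neg_neg, real_inner_comm,
      InnerProductSpace.toDual_symm_apply]
  obtain ⟨y, hy, hysupp⟩ := exists_inner_eq_supportFn hK hne φ
  have hly := hlK y hy
  have hle := h φ
  rw [← hysupp] at hle
  rw [hl] at hly hlx
  nlinarith [norm_nonneg u]

end SupportFn

/-- The support function about the point `P` of the curve with generalized support function `p`:
the signed distance from `P` to the support line with normal angle `φ`. -/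
noncomputable def gap (p : ℝ → ℝ) (P : Plane) (φ : ℝ) : ℝ :=
  p φ - inner ℝ P (normalVec φ)

theorem gap_periodic {p : ℝ → ℝ} (hper : Function.Periodic p (2 * π)) (P : Plane) :
    Function.Periodic (gap p P) (2 * π) := by
  intro φ
  simp only [gap, hper φ, normalVec_periodic φ]

theorem hasDerivAt_gap {p : ℝ → ℝ} {p' φ : ℝ} (hp : HasDerivAt p p' φ) (P : Plane) :
    HasDerivAt (gap p P) (p' - inner ℝ P (tangentVec φ)) φ :=
  hp.sub (hasDerivAt_inner_normalVec P φ)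

theorem eq_envelope_iff {p : ℝ → ℝ} {φ : ℝ} (hp : DifferentiableAt ℝ p φ) {P : Plane} :
    P = envelope p φ ↔ gap p P φ = 0 ∧ deriv (gap p P) φ = 0 := by
  rw [(hasDerivAt_gap hp.hasDerivAt P).deriv, gap, sub_eq_zero, sub_eq_zero]
  constructor
  · rintro rfl
    simp [inner_envelope_normalVec, inner_envelope_tangentVec]
  · rintro ⟨hnormal, htangent⟩
    apply plane_ext_of_inner φ
    · simp [inner_envelope_normalVec, hnormal]
    · simp [inner_envelope_tangentVec, htangent]

theorem envelope_sub_eq {p : ℝ → ℝ} {φ : ℝ} (hp : DifferentiableAt ℝ p φ) {P : Plane}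
    (h : gap p P φ = 0) : envelope p φ - P = deriv (gap p P) φ • tangentVec φ := by
  rw [(hasDerivAt_gap hp.hasDerivAt P).deriv]
  apply plane_ext_of_inner φ
  · rw [inner_sub_left, real_inner_smul_left, inner_tangentVec_normalVec, sub_self, Real.sin_zero,
      inner_envelope_normalVec_self, mul_zero]
    exact h
  · rw [inner_sub_left, real_inner_smul_left, inner_tangentVec_tangentVec,
      inner_envelope_tangentVec]
    simp

namespace PositivelyCurved

variable {p : ℝ → ℝ} (hp : PositivelyCurved p)
include hp

theorem hasDerivAt (φ : ℝ) : HasDerivAt p (deriv p φ) φ :=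
  hasDerivAt_of_contDiff_two hp.contDiff φ

theorem deriv_gap (P : Plane) :
    deriv (gap p P) = fun φ => deriv p φ - inner ℝ P (tangentVec φ) :=
  funext fun φ => (hasDerivAt_gap (hp.hasDerivAt φ) P).deriv

protected theorem gap (P : Plane) : PositivelyCurved (gap p P) where
  contDiff := hp.contDiff.sub (contDiff_inner_normalVec P 2)
  curvature_pos φ := by
    rw [hp.deriv_gap, ((hasDerivAt_deriv_of_contDiff_two hp.contDiff φ).fun_sub
      (hasDerivAt_inner_tangentVec P φ)).deriv, gap]
    linarith [hp.curvature_pos φ]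

theorem gap_envelope_pos (hper : Function.Periodic p (2 * π)) {a x : ℝ}
    (hx : x ∈ Ioo a (a + 2 * π)) : 0 < gap p (envelope p a) x := by
  obtain ⟨h0, h1⟩ := (eq_envelope_iff (hp.hasDerivAt a).differentiableAt).1 rfl
  exact (hp.gap _).pos_of_double_zero (gap_periodic hper _) h0 h1 hx

theorem envelope_injOn (hper : Function.Periodic p (2 * π)) (a : ℝ) :
    InjOn (envelope p) (Ico a (a + 2 * π)) := by
  have hne (x y : ℝ) (hxy : x < y) (hyx : y < x + 2 * π) : envelope p x ≠ envelope p y := by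
    intro heq
    have hpos := hp.gap_envelope_pos hper (a := x) ⟨hxy, hyx⟩
    rw [heq, gap, inner_envelope_normalVec_self, sub_self] at hpos
    exact lt_irrefl 0 hpos
  intro x hx y hy heq
  rcases lt_trichotomy x y with h | h | h
  · exact absurd heq (hne x y h (by linarith [hx.1, hy.2]))
  · exact h
  · exact absurd heq.symm (hne y x h (by linarith [hy.1, hx.2]))

end PositivelyCurved

namespace IsStrictlyConvexC2

variable {K : Set Plane} (hK : IsStrictlyConvexC2 K)
include hK

theorem positivelyCurved : PositivelyCurved (supportFn K) :=
  ⟨hK.contDiff, hK.curvature_pos⟩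

theorem continuous_deriv : Continuous (deriv (supportFn K)) :=
  hK.contDiff.continuous_deriv one_le_two

theorem eq_envelope {x : Plane} (hx : x ∈ K) {φ : ℝ}
    (h : inner ℝ x (normalVec φ) = supportFn K φ) : x = envelope (supportFn K) φ := by
  have hmin : IsLocalMin (gap (supportFn K) x) φ := Filter.Eventually.of_forall fun t => by
    simpa [gap, h] using inner_le_supportFn hK.isCompact hx t
  exact (eq_envelope_iff (hK.positivelyCurved.hasDerivAt φ).differentiableAt).2
    ⟨sub_eq_zero.2 h.symm, hmin.deriv_eq_zero⟩

theorem envelope_mem (φ : ℝ) : envelope (supportFn K) φ ∈ K := by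
  obtain ⟨x, hx, h⟩ := exists_inner_eq_supportFn hK.isCompact hK.nonempty φ
  rwa [← hK.eq_envelope hx h]

theorem mem_iff_gap_nonneg (P : Plane) : P ∈ K ↔ ∀ φ, 0 ≤ gap (supportFn K) P φ := by
  simp only [gap, sub_nonneg]
  exact ⟨fun hP φ => inner_le_supportFn hK.isCompact hP φ,
    mem_of_forall_inner_le hK.isCompact hK.convex hK.nonempty⟩

end IsStrictlyConvexC2

/-! ### Pairs of tangents and the visual angle -/

theorem angle_tangentVec (φ : ℝ) {δ : ℝ} (h0 : 0 ≤ δ) (hπ : δ ≤ π) :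
    InnerProductGeometry.angle (tangentVec φ) (tangentVec (φ + δ)) = δ := by
  rw [InnerProductGeometry.angle, norm_tangentVec, norm_tangentVec, inner_tangentVec_tangentVec,
    mul_one, div_one, add_sub_cancel_left, Real.arccos_cos h0 hπ]

/-- The tangents with normal angles `φ` and `φ + δ`, where `0 < δ < π`, to the curve with
generalized support function `p` both pass through `P`. -/
structure IsTangentPair (p : ℝ → ℝ) (P : Plane) (δ φ : ℝ) : Prop where
  mem_Ioo : δ ∈ Ioo 0 π
  gap_left : gap p P φ = 0
  gap_right : gap p P (φ + δ) = 0

theorem PositivelyCurved.exists_isTangentPair {p : ℝ → ℝ} (hp : PositivelyCurved p)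
    (hper : Function.Periodic p (2 * π)) {P : Plane} {c : ℝ} (hc : gap p P c < 0) :
    ∃ δ, ∃ φ ∈ Ico 0 (2 * π), IsTangentPair p P δ φ := by
  obtain ⟨a, b, hab, hba, ha, hb⟩ := (hp.gap P).exists_zeros_of_neg (gap_periodic hper P) hc
  have hmod := toIcoMod_mem_Ico Real.two_pi_pos 0 a
  rw [zero_add, toIcoMod] at hmod
  refine ⟨b - a, _, hmod, ⟨by linarith, by linarith⟩, ?_, ?_⟩
  · rw [(gap_periodic hper P).sub_zsmul_eq, ha]
  · rw [sub_add_sub_cancel', (gap_periodic hper P).sub_zsmul_eq, hb]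

namespace IsTangentPair

variable {p : ℝ → ℝ} {P : Plane} {δ φ : ℝ} (h : IsTangentPair p P δ φ) (hp : PositivelyCurved p)
include h

theorem sin_pos : 0 < Real.sin δ :=
  Real.sin_pos_of_mem_Ioo h.mem_Ioo

theorem lt_add : φ < φ + δ := by
  linarith [h.mem_Ioo.1]

theorem add_lt_add_pi : φ + δ < φ + π := by
  linarith [h.mem_Ioo.2]

include hp

theorem deriv_gap_left_neg : deriv (gap p P) φ < 0 :=
  (hp.gap P).deriv_neg_of_zeros h.gap_left h.gap_right h.lt_add h.add_lt_add_pi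

theorem deriv_gap_right_pos : 0 < deriv (gap p P) (φ + δ) :=
  (hp.gap P).deriv_pos_of_zeros h.gap_left h.gap_right h.lt_add h.add_lt_add_pi

theorem angle_envelope :
    EuclideanGeometry.angle (envelope p φ) P (envelope p (φ + δ)) = π - δ := by
  rw [EuclideanGeometry.angle, vsub_eq_sub, vsub_eq_sub,
    envelope_sub_eq (hp.hasDerivAt _).differentiableAt h.gap_left,
    envelope_sub_eq (hp.hasDerivAt _).differentiableAt h.gap_right,
    InnerProductGeometry.angle_smul_left_of_neg _ _ (h.deriv_gap_left_neg hp),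
    InnerProductGeometry.angle_smul_right_of_pos _ _ (h.deriv_gap_right_pos hp),
    InnerProductGeometry.angle_neg_left, angle_tangentVec φ h.mem_Ioo.1.le h.mem_Ioo.2.le]

theorem left_ne_right {δ' φ' : ℝ} (h' : IsTangentPair p P δ' φ') : φ' ≠ φ + δ := by
  rintro rfl
  exact lt_asymm (h'.deriv_gap_left_neg hp) (h.deriv_gap_right_pos hp)

variable (hper : Function.Periodic p (2 * π))
include hper

theorem eq_or_eq {ψ : ℝ} (hψ : ψ ∈ Ico φ (φ + 2 * π)) (h0 : gap p P ψ = 0) :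
    ψ = φ ∨ ψ = φ + δ :=
  (hp.gap P).eq_or_eq_of_zeros (gap_periodic hper P) h.gap_left h.gap_right h.lt_add
    h.add_lt_add_pi hψ h0

theorem envelope_eq_or_eq {ψ : ℝ} (h0 : gap p P ψ = 0) :
    envelope p ψ = envelope p φ ∨ envelope p ψ = envelope p (φ + δ) := by
  have hmem := toIcoMod_mem_Ico Real.two_pi_pos φ ψ
  rw [toIcoMod] at hmem
  rw [← (envelope_periodic hper).sub_zsmul_eq (toIcoDiv Real.two_pi_pos φ ψ)]
  refine (h.eq_or_eq hp hper hmem ?_).imp (congrArg _) (congrArg _)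
  rw [(gap_periodic hper P).sub_zsmul_eq, h0]

theorem right_unique {δ' : ℝ} (h' : IsTangentPair p P δ' φ) : δ = δ' := by
  rcases h.eq_or_eq hp hper ⟨h'.lt_add.le, by linarith [h'.add_lt_add_pi, Real.pi_pos]⟩
    h'.gap_right with heq | heq
  · linarith [h'.lt_add]
  · linarith

theorem left_unique {δ' φ' : ℝ} (h' : IsTangentPair p P δ' φ') (hφ : φ ∈ Ico 0 (2 * π))
    (hφ' : φ' ∈ Ico 0 (2 * π)) : φ = φ' := by
  wlog hle : φ ≤ φ' generalizing δ δ' φ φ'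
  · exact (this h' h hφ' hφ (le_of_not_ge hle)).symm
  rcases h.eq_or_eq hp hper ⟨hle, by linarith [hφ.1, hφ'.2]⟩ h'.gap_left with heq | heq
  · exact heq.symm
  · exact absurd heq (h.left_ne_right hp h')

end IsTangentPair

namespace IsStrictlyConvexC2

variable {K : Set Plane} (hK : IsStrictlyConvexC2 K)
include hK

theorem notMem_of_isTangentPair {P : Plane} {δ φ : ℝ}
    (h : IsTangentPair (supportFn K) P δ φ) : P ∉ K := by
  intro hP
  have hmin : IsLocalMin (gap (supportFn K) P) φ :=
    Filter.Eventually.of_forall fun t => h.gap_left ▸ (hK.mem_iff_gap_nonneg P).1 hP t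
  exact (h.deriv_gap_left_neg hK.positivelyCurved).ne hmin.deriv_eq_zero

theorem exists_isTangentPair {P : Plane} (hP : P ∉ K) :
    ∃ δ, ∃ φ ∈ Ico 0 (2 * π), IsTangentPair (supportFn K) P δ φ := by
  rw [hK.mem_iff_gap_nonneg] at hP
  push Not at hP
  obtain ⟨c, hc⟩ := hP
  exact hK.positivelyCurved.exists_isTangentPair (supportFn_periodic K) hc

theorem isTangencyPoint_envelope {P : Plane} {φ : ℝ} (h : gap (supportFn K) P φ = 0) :
    IsTangencyPoint K P (envelope (supportFn K) φ) := by
  refine ⟨hK.envelope_mem φ, normalVec φ, ?_, ?_, fun y hy => ?_⟩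
  · exact norm_ne_zero_iff.1 (by simp [norm_normalVec])
  · rw [real_inner_comm, real_inner_comm _ (normalVec φ), inner_envelope_normalVec_self]
    exact (sub_eq_zero.1 h).symm
  · rw [real_inner_comm, real_inner_comm _ (normalVec φ), inner_envelope_normalVec_self]
    exact inner_le_supportFn hK.isCompact hy φ

theorem exists_eq_envelope_of_isTangencyPoint {P x : Plane} (h : IsTangencyPoint K P x) :
    ∃ φ, x = envelope (supportFn K) φ ∧ gap (supportFn K) P φ = 0 := by
  obtain ⟨hx, u, hu, huP, hmax⟩ := h
  obtain ⟨φ, hφ⟩ := exists_eq_norm_smul_normalVec u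
  have hnorm : 0 < ‖u‖ := norm_pos_iff.2 hu
  have hinner (z : Plane) : inner ℝ u z = ‖u‖ * inner ℝ z (normalVec φ) := by
    conv_lhs => rw [hφ]
    rw [real_inner_smul_left, real_inner_comm]
  simp only [hinner] at huP hmax
  obtain ⟨y, hy, hysupp⟩ := exists_inner_eq_supportFn hK.isCompact hK.nonempty φ
  have hxsupp : inner ℝ x (normalVec φ) = supportFn K φ :=
    le_antisymm (inner_le_supportFn hK.isCompact hx φ)
      (hysupp ▸ le_of_mul_le_mul_left (hmax y hy) hnorm)
  exact ⟨φ, hK.eq_envelope hx hxsupp,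
    by rw [gap, mul_left_cancel₀ hnorm.ne' huP, hxsupp, sub_self]⟩

theorem visualAngle_eq {P : Plane} {δ φ : ℝ} (h : IsTangentPair (supportFn K) P δ φ) :
    visualAngle K P = π - δ := by
  have hangle := h.angle_envelope hK.positivelyCurved
  have hself (ψ : ℝ) : EuclideanGeometry.angle (envelope (supportFn K) ψ) P
      (envelope (supportFn K) ψ) = 0 :=
    EuclideanGeometry.angle_self_of_ne fun heq =>
      hK.notMem_of_isTangentPair h (heq ▸ hK.envelope_mem ψ)
  have hpoint (x : Plane) (hx : IsTangencyPoint K P x) :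
      x = envelope (supportFn K) φ ∨ x = envelope (supportFn K) (φ + δ) := by
    obtain ⟨ψ, rfl, h0⟩ := hK.exists_eq_envelope_of_isTangencyPoint hx
    exact h.envelope_eq_or_eq hK.positivelyCurved (supportFn_periodic K) h0
  have hnonneg : 0 ≤ π - δ := by linarith [h.mem_Ioo.2]
  refine IsGreatest.csSup_eq ⟨⟨_, _, hK.isTangencyPoint_envelope h.gap_left,
    hK.isTangencyPoint_envelope h.gap_right, hangle.symm⟩, ?_⟩
  rintro θ ⟨x, y, hx, hy, rfl⟩
  rcases hpoint x hx with rfl | rfl <;> rcases hpoint y hy with rfl | rfl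
  · rwa [hself]
  · rw [hangle]
  · rw [EuclideanGeometry.angle_comm, hangle]
  · rwa [hself]

end IsStrictlyConvexC2

/-! ### Change of variables in the plane -/

/-- The linear form `(x, y) ↦ a x + b y`, as which differentials on `ℝ × ℝ` are written. -/
def linearForm (a b : ℝ) : ℝ × ℝ →L[ℝ] ℝ :=
  a • ContinuousLinearMap.fst ℝ ℝ ℝ + b • ContinuousLinearMap.snd ℝ ℝ ℝ

theorem linearForm_apply (a b : ℝ) (z : ℝ × ℝ) : linearForm a b z = a * z.1 + b * z.2 :=
  rfl

theorem det_linearForm_prod (a b c d : ℝ) :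
    ((linearForm a b).prod (linearForm c d)).det = a * d - b * c := by
  rw [ContinuousLinearMap.det, ← LinearMap.det_toMatrix (Module.Basis.finTwoProd ℝ),
    Matrix.det_fin_two]
  simp [LinearMap.toMatrix_apply, linearForm_apply]

/-- The Euclidean plane as the product `ℝ × ℝ`, on which the area formula is applied. -/
noncomputable def planeEquiv : Plane ≃ᵐ ℝ × ℝ :=
  (MeasurableEquiv.toLp 2 (Fin 2 → ℝ)).symm.trans MeasurableEquiv.finTwoArrow

theorem measurePreserving_planeEquiv : MeasurePreserving planeEquiv volume volume :=
  (volume_preserving_finTwoArrow ℝ).comp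
    (EuclideanSpace.volume_preserving_symm_measurableEquiv_toLp (Fin 2))

theorem planeEquiv_symm_apply (z : ℝ × ℝ) : planeEquiv.symm z = !₂[z.1, z.2] :=
  rfl

section ChangeOfVariables

variable {S : Set (ℝ × ℝ)} (hS : MeasurableSet S) {X Y a b c d : ℝ × ℝ → ℝ}
  (hX : ∀ z ∈ S, HasFDerivAt X (linearForm (a z) (b z)) z)
  (hY : ∀ z ∈ S, HasFDerivAt Y (linearForm (c z) (d z)) z)
  (hinj : InjOn (fun z => (!₂[X z, Y z] : Plane)) S) (g : Plane → ℝ)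

theorem image_plane_eq :
    (fun z => (!₂[X z, Y z] : Plane)) '' S = planeEquiv.symm '' ((fun z => (X z, Y z)) '' S) := by
  rw [image_image]
  rfl

include hS hX hY hinj

theorem integrableOn_image_plane_iff :
    IntegrableOn g ((fun z => (!₂[X z, Y z] : Plane)) '' S) ↔
      IntegrableOn (fun z => |a z * d z - b z * c z| * g !₂[X z, Y z]) S := by
  rw [image_plane_eq,
    measurePreserving_planeEquiv.symm.integrableOn_image planeEquiv.symm.measurableEmbedding,
    integrableOn_image_iff_integrableOn_abs_det_fderiv_smul volume hS
      (fun z hz => ((hX z hz).prodMk (hY z hz)).hasFDerivWithinAt)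
      (fun z hz w hw h => hinj hz hw (by simpa using h))]
  simp only [det_linearForm_prod, smul_eq_mul, Function.comp, planeEquiv_symm_apply]

theorem setIntegral_image_plane :
    ∫ P in (fun z => (!₂[X z, Y z] : Plane)) '' S, g P =
      ∫ z in S, |a z * d z - b z * c z| * g !₂[X z, Y z] := by
  rw [image_plane_eq,
    measurePreserving_planeEquiv.symm.setIntegral_image_emb planeEquiv.symm.measurableEmbedding,
    integral_image_eq_integral_abs_det_fderiv_smul volume hS
      (fun z hz => ((hX z hz).prodMk (hY z hz)).hasFDerivWithinAt)
      (fun z hz w hw h => hinj hz hw (by simpa using h))]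
  simp only [det_linearForm_prod, smul_eq_mul, planeEquiv_symm_apply]

end ChangeOfVariables

/-! ### Exterior points as intersections of two tangents -/

/-- For `z = (δ, φ)`, the signed distance from the foot of the perpendicular from the origin to the
tangent with normal angle `φ` to the intersection with the tangent with normal angle `φ + δ`. -/
noncomputable def footDist (p : ℝ → ℝ) (z : ℝ × ℝ) : ℝ :=
  (p (z.2 + z.1) - p z.2 * Real.cos z.1) / Real.sin z.1

/-- For `z = (δ, φ)`, the distance from the intersection of the tangents with normal angles `φ` and
`φ + δ` to the point of contact of the first. -/
noncomputable def tangentLengthLeft (p : ℝ → ℝ) (z : ℝ × ℝ) : ℝ :=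
  footDist p z - deriv p z.2

/-- For `z = (δ, φ)`, the distance from the intersection of the tangents with normal angles `φ` and
`φ + δ` to the point of contact of the second. -/
noncomputable def tangentLengthRight (p : ℝ → ℝ) (z : ℝ × ℝ) : ℝ :=
  (p z.2 - p (z.2 + z.1) * Real.cos z.1) / Real.sin z.1 + deriv p (z.2 + z.1)

/-- For `z = (δ, φ)`, the intersection of the tangents with normal angles `φ` and `φ + δ`. -/
noncomputable def tangentMeet (p : ℝ → ℝ) (z : ℝ × ℝ) : Plane :=
  !₂[p z.2 * Real.cos z.2 - footDist p z * Real.sin z.2,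
    p z.2 * Real.sin z.2 + footDist p z * Real.cos z.2]

section TangentMeet

variable (p : ℝ → ℝ) {z : ℝ × ℝ}

theorem inner_tangentMeet_normalVec (z : ℝ × ℝ) (φ : ℝ) :
    inner ℝ (tangentMeet p z) (normalVec φ) =
      p z.2 * Real.cos (φ - z.2) + footDist p z * Real.sin (φ - z.2) := by
  rw [inner_normalVec, Real.cos_sub, Real.sin_sub]
  simp only [tangentMeet, Matrix.cons_val_zero, Matrix.cons_val_one]
  ring

theorem inner_tangentMeet_tangentVec (z : ℝ × ℝ) (φ : ℝ) :
    inner ℝ (tangentMeet p z) (tangentVec φ) =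
      footDist p z * Real.cos (φ - z.2) - p z.2 * Real.sin (φ - z.2) := by
  rw [inner_tangentVec, Real.cos_sub, Real.sin_sub]
  simp only [tangentMeet, Matrix.cons_val_zero, Matrix.cons_val_one]
  ring

theorem isTangentPair_tangentMeet (hz : z.1 ∈ Ioo 0 π) :
    IsTangentPair p (tangentMeet p z) z.1 z.2 where
  mem_Ioo := hz
  gap_left := by simp [gap, inner_tangentMeet_normalVec]
  gap_right := by
    rw [gap, inner_tangentMeet_normalVec, footDist, add_sub_cancel_left,
      div_mul_cancel₀ _ (Real.sin_pos_of_mem_Ioo hz).ne']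
    ring

variable {p}

theorem IsTangentPair.eq_tangentMeet {P : Plane} (h : IsTangentPair p P z.1 z.2) :
    P = tangentMeet p z := by
  have hleft : p z.2 = inner ℝ P (normalVec z.2) := sub_eq_zero.1 h.gap_left
  have hright : p (z.2 + z.1) = inner ℝ P (normalVec z.2) * Real.cos z.1 +
      inner ℝ P (tangentVec z.2) * Real.sin z.1 := by
    rw [sub_eq_zero.1 h.gap_right, inner_normalVec, inner_normalVec, inner_tangentVec,
      Real.cos_add, Real.sin_add]
    ring
  apply plane_ext_of_inner z.2
  · simp [inner_tangentMeet_normalVec, hleft]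
  · rw [inner_tangentMeet_tangentVec, footDist, hright, hleft, add_sub_cancel_left,
      mul_div_cancel_right₀ _ h.sin_pos.ne']
    simp

variable (hp : PositivelyCurved p)
include hp

theorem tangentLengthLeft_pos (hz : z.1 ∈ Ioo 0 π) : 0 < tangentLengthLeft p z := by
  have h := (isTangentPair_tangentMeet p hz).deriv_gap_left_neg hp
  simp only [hp.deriv_gap, inner_tangentMeet_tangentVec, sub_self, Real.cos_zero,
    Real.sin_zero] at h
  rw [tangentLengthLeft]
  linarith

theorem tangentLengthRight_pos (hz : z.1 ∈ Ioo 0 π) : 0 < tangentLengthRight p z := by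
  have h := (isTangentPair_tangentMeet p hz).deriv_gap_right_pos hp
  have hsin := (Real.sin_pos_of_mem_Ioo hz).ne'
  simp only [hp.deriv_gap, inner_tangentMeet_tangentVec, footDist, add_sub_cancel_left] at h
  refine h.trans_eq ?_
  rw [tangentLengthRight]
  field_simp
  linear_combination p z.2 * Real.sin_sq_add_cos_sq z.1

end TangentMeet

/-- The derivative of `footDist p (δ, φ)` with respect to `φ`. -/
noncomputable def footDistSlope (p : ℝ → ℝ) (z : ℝ × ℝ) : ℝ :=
  (deriv p (z.2 + z.1) - deriv p z.2 * Real.cos z.1) / Real.sin z.1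

section Jacobian

variable {p : ℝ → ℝ} (hp : Differentiable ℝ p) {z : ℝ × ℝ} (hz : Real.sin z.1 ≠ 0)
include hp hz

theorem hasFDerivAt_footDist :
    HasFDerivAt (footDist p)
      (linearForm (tangentLengthRight p z / Real.sin z.1) (footDistSlope p z)) z := by
  have hfst : HasFDerivAt (fun z : ℝ × ℝ => z.1) (ContinuousLinearMap.fst ℝ ℝ ℝ) z :=
    hasFDerivAt_fst
  have hsnd : HasFDerivAt (fun z : ℝ × ℝ => z.2) (ContinuousLinearMap.snd ℝ ℝ ℝ) z :=
    hasFDerivAt_snd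
  have hp₁ := (hp z.2).hasDerivAt.comp_hasFDerivAt z hsnd
  have hp₂ := (hp (z.2 + z.1)).hasDerivAt.comp_hasFDerivAt z (hsnd.add hfst)
  have hinv := (hasDerivAt_inv hz).comp_hasFDerivAt z hfst.sin
  refine (((hp₂.sub (hp₁.mul hfst.cos)).mul hinv).congr_fderiv ?_).congr_of_eventuallyEq
    (Filter.Eventually.of_forall fun w => div_eq_mul_inv _ _)
  refine ContinuousLinearMap.ext fun v => ?_
  simp only [tangentLengthRight, footDistSlope, linearForm_apply, Pi.sub_apply, Pi.add_apply,
    Pi.mul_apply, Function.comp_apply, add_apply, sub_apply, smul_apply,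
    ContinuousLinearMap.coe_fst', ContinuousLinearMap.coe_snd', smul_eq_mul]
  field_simp
  linear_combination p z.2 * v.1 * Real.sin_sq_add_cos_sq z.1

theorem hasFDerivAt_tangentMeet_zero :
    HasFDerivAt (fun z : ℝ × ℝ => p z.2 * Real.cos z.2 - footDist p z * Real.sin z.2)
      (linearForm (-(tangentLengthRight p z / Real.sin z.1) * Real.sin z.2)
        (-tangentLengthLeft p z * Real.cos z.2 - (p z.2 + footDistSlope p z) *
          Real.sin z.2)) z := by
  have hsnd : HasFDerivAt (fun z : ℝ × ℝ => z.2) (ContinuousLinearMap.snd ℝ ℝ ℝ) z :=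
    hasFDerivAt_snd
  refine ((((hp z.2).hasDerivAt.comp_hasFDerivAt z hsnd).mul hsnd.cos).sub
    ((hasFDerivAt_footDist hp hz).mul hsnd.sin)).congr_fderiv ?_
  ext <;> simp [tangentLengthLeft, linearForm_apply] <;> ring

theorem hasFDerivAt_tangentMeet_one :
    HasFDerivAt (fun z : ℝ × ℝ => p z.2 * Real.sin z.2 + footDist p z * Real.cos z.2)
      (linearForm (tangentLengthRight p z / Real.sin z.1 * Real.cos z.2)
        (-tangentLengthLeft p z * Real.sin z.2 + (p z.2 + footDistSlope p z) *
          Real.cos z.2)) z := by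
  have hsnd : HasFDerivAt (fun z : ℝ × ℝ => z.2) (ContinuousLinearMap.snd ℝ ℝ ℝ) z :=
    hasFDerivAt_snd
  refine ((((hp z.2).hasDerivAt.comp_hasFDerivAt z hsnd).mul hsnd.sin).add
    ((hasFDerivAt_footDist hp hz).mul hsnd.cos)).congr_fderiv ?_
  ext <;> simp [tangentLengthLeft, linearForm_apply] <;> ring

end Jacobian

/-- The pairs `(δ, φ)` of parameters of the intersection points of two tangents, each point outside
a convex curve being attained once. -/
def tangentDomain : Set (ℝ × ℝ) := Ioo 0 π ×ˢ Ico 0 (2 * π)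

theorem measurableSet_tangentDomain : MeasurableSet tangentDomain :=
  measurableSet_Ioo.prod measurableSet_Ico

theorem sin_pos_of_mem_tangentDomain {z : ℝ × ℝ} (hz : z ∈ tangentDomain) : 0 < Real.sin z.1 :=
  Real.sin_pos_of_mem_Ioo hz.1

theorem tangentMeet_injOn {p : ℝ → ℝ} (hp : PositivelyCurved p)
    (hper : Function.Periodic p (2 * π)) : InjOn (tangentMeet p) tangentDomain := by
  rintro ⟨δ, φ⟩ hz ⟨δ', φ'⟩ hw heq
  have hpair := isTangentPair_tangentMeet p hz.1
  have hpair' := isTangentPair_tangentMeet p hw.1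
  rw [← heq] at hpair'
  obtain rfl : φ = φ' := hpair.left_unique hp hper hpair' hz.2 hw.2
  exact Prod.ext (hpair.right_unique hp hper hpair') rfl

/-- The density of the area element with respect to `dδ dφ` in the coordinates of `tangentMeet`. -/
noncomputable def tangentDensity (p : ℝ → ℝ) (z : ℝ × ℝ) : ℝ :=
  tangentLengthLeft p z * tangentLengthRight p z / Real.sin z.1

theorem abs_jacobian_tangentMeet {p : ℝ → ℝ} (hp : PositivelyCurved p) {z : ℝ × ℝ}
    (hz : z ∈ tangentDomain) (q : ℝ) :
    |-(tangentLengthRight p z / Real.sin z.1) * Real.sin z.2 *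
        (-tangentLengthLeft p z * Real.sin z.2 + q * Real.cos z.2) -
      (-tangentLengthLeft p z * Real.cos z.2 - q * Real.sin z.2) *
        (tangentLengthRight p z / Real.sin z.1 * Real.cos z.2)| = tangentDensity p z := by
  have hpos : 0 < tangentDensity p z :=
    div_pos (mul_pos (tangentLengthLeft_pos hp hz.1) (tangentLengthRight_pos hp hz.1))
      (sin_pos_of_mem_tangentDomain hz)
  rw [← abs_of_pos hpos, tangentDensity]
  congr 1
  linear_combination tangentLengthLeft p z * tangentLengthRight p z / Real.sin z.1 *
    Real.sin_sq_add_cos_sq z.2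

namespace IsStrictlyConvexC2

variable {K : Set Plane} (hK : IsStrictlyConvexC2 K)
include hK

theorem differentiable : Differentiable ℝ (supportFn K) :=
  hK.contDiff.differentiable two_ne_zero

theorem image_tangentMeet : tangentMeet (supportFn K) '' tangentDomain = Kᶜ := by
  ext P
  constructor
  · rintro ⟨z, hz, rfl⟩
    exact hK.notMem_of_isTangentPair (isTangentPair_tangentMeet _ hz.1)
  · intro hP
    obtain ⟨δ, φ, hφ, hpair⟩ := hK.exists_isTangentPair hP
    exact ⟨(δ, φ), ⟨hpair.mem_Ioo, hφ⟩, (hpair.eq_tangentMeet (z := (δ, φ))).symm⟩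

theorem visualAngle_tangentMeet {z : ℝ × ℝ} (hz : z ∈ tangentDomain) :
    visualAngle K (tangentMeet (supportFn K) z) = π - z.1 :=
  hK.visualAngle_eq (isTangentPair_tangentMeet _ hz.1)

theorem integrableOn_visualAngle_iff (g : ℝ → ℝ) :
    IntegrableOn (fun P => g (visualAngle K P)) Kᶜ ↔
      IntegrableOn (fun z => tangentDensity (supportFn K) z * g (π - z.1)) tangentDomain := by
  rw [← hK.image_tangentMeet]
  refine (integrableOn_image_plane_iff measurableSet_tangentDomain
    (fun z hz => hasFDerivAt_tangentMeet_zero hK.differentiable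
      (sin_pos_of_mem_tangentDomain hz).ne')
    (fun z hz => hasFDerivAt_tangentMeet_one hK.differentiable
      (sin_pos_of_mem_tangentDomain hz).ne')
    (tangentMeet_injOn hK.positivelyCurved (supportFn_periodic K)) _).trans
      (integrableOn_congr_fun (fun z hz => ?_) measurableSet_tangentDomain)
  exact congrArg₂ (· * ·) (abs_jacobian_tangentMeet hK.positivelyCurved hz _)
    (congrArg g (hK.visualAngle_tangentMeet hz))

theorem setIntegral_visualAngle (g : ℝ → ℝ) :
    ∫ P in Kᶜ, g (visualAngle K P) =
      ∫ z in tangentDomain, tangentDensity (supportFn K) z * g (π - z.1) := by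
  rw [← hK.image_tangentMeet]
  refine (setIntegral_image_plane measurableSet_tangentDomain
    (fun z hz => hasFDerivAt_tangentMeet_zero hK.differentiable
      (sin_pos_of_mem_tangentDomain hz).ne')
    (fun z hz => hasFDerivAt_tangentMeet_one hK.differentiable
      (sin_pos_of_mem_tangentDomain hz).ne')
    (tangentMeet_injOn hK.positivelyCurved (supportFn_periodic K)) _).trans
      (setIntegral_congr_fun measurableSet_tangentDomain fun z hz => ?_)
  exact congrArg₂ (· * ·) (abs_jacobian_tangentMeet hK.positivelyCurved hz _)
    (congrArg g (hK.visualAngle_tangentMeet hz))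

end IsStrictlyConvexC2

/-! ### Integrability over the exterior -/

theorem exists_abs_lt_of_periodic {f : ℝ → ℝ} {c : ℝ} (hc : 0 < c) (hf : Continuous f)
    (hper : Function.Periodic f c) : ∃ M, ∀ x, |f x| < M := by
  obtain ⟨M, hM⟩ := isCompact_Icc.exists_bound_of_continuousOn
    (hf.continuousOn (s := Icc 0 c))
  refine ⟨M + 1, fun x => ?_⟩
  obtain ⟨y, hy, heq⟩ := hper.exists_mem_Ico₀ hc x
  rw [heq]
  exact (hM y ⟨hy.1, hy.2.le⟩).trans_lt (lt_add_one M)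

theorem exists_curvature_lt {p : ℝ → ℝ} (hp : ContDiff ℝ 2 p)
    (hper : Function.Periodic p (2 * π)) : ∃ M, ∀ φ, p φ + deriv (deriv p) φ < M := by
  obtain ⟨M, hM⟩ := exists_abs_lt_of_periodic Real.two_pi_pos
    (hp.continuous.add (continuous_deriv_deriv_of_contDiff_two hp))
    (hper.add (deriv_periodic (deriv_periodic hper)))
  exact ⟨M, fun φ => (le_abs_self _).trans_lt (hM φ)⟩

theorem positivelyCurved_const_sub {p : ℝ → ℝ} (hp : ContDiff ℝ 2 p) {M : ℝ}
    (hM : ∀ φ, p φ + deriv (deriv p) φ < M) : PositivelyCurved fun φ => M - p φ where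
  contDiff := contDiff_const.sub hp
  curvature_pos φ := by
    rw [deriv_const_sub', deriv.fun_neg']
    linarith [hM φ]

section TangentLengthBound

variable {p : ℝ → ℝ} (hp : ContDiff ℝ 2 p) {M : ℝ} (hM : ∀ φ, p φ + deriv (deriv p) φ < M)
  {z : ℝ × ℝ} (hz : z.1 ∈ Ioo 0 π)
include hp hM hz

theorem sin_mul_tangentLengthLeft_lt :
    Real.sin z.1 * tangentLengthLeft p z < M * (1 - Real.cos z.1) := by
  have h := (positivelyCurved_const_sub hp hM).cos_add_sin_lt (a := z.2) (x := z.2 + z.1)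
    (by linarith [hz.1]) (by rw [add_sub_cancel_left, abs_of_pos hz.1]; exact hz.2.le)
  rw [deriv_const_sub, add_sub_cancel_left] at h
  rw [tangentLengthLeft, footDist, mul_sub,
    mul_div_cancel₀ _ (Real.sin_pos_of_mem_Ioo hz).ne']
  linarith

theorem sin_mul_tangentLengthRight_lt :
    Real.sin z.1 * tangentLengthRight p z < M * (1 - Real.cos z.1) := by
  have h := (positivelyCurved_const_sub hp hM).cos_add_sin_lt (a := z.2 + z.1) (x := z.2)
    (by linarith [hz.1]) (by rw [sub_add_cancel_left, abs_neg, abs_of_pos hz.1]; exact hz.2.le)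
  rw [deriv_const_sub, sub_add_cancel_left, Real.cos_neg, Real.sin_neg] at h
  rw [tangentLengthRight, mul_add, mul_div_cancel₀ _ (Real.sin_pos_of_mem_Ioo hz).ne']
  linarith

end TangentLengthBound

/-- The function of the visual angle whose integral over the exterior is considered. -/
noncomputable def angleFn (u : ℝ) : ℝ := u - Real.sin u - (2 / 3) * Real.sin u ^ 3

theorem continuous_angleFn : Continuous angleFn := by
  unfold angleFn
  fun_prop

theorem abs_angleFn_le {u : ℝ} (h0 : 0 ≤ u) (hπ : u ≤ π) : |angleFn u| ≤ u ^ 3 := by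
  rcases eq_or_lt_of_le h0 with rfl | hpos
  · simp [angleFn]
  have hsin_gt := Real.sin_gt_sub_cube hpos
  have hsin_le := Real.sin_le h0
  have hsin_nonneg := Real.sin_nonneg_of_nonneg_of_le_pi h0 hπ
  have hcube_le : Real.sin u ^ 3 ≤ u ^ 3 := by gcongr
  have hcube_nonneg : 0 ≤ Real.sin u ^ 3 := by positivity
  rw [abs_le, angleFn]
  constructor <;> linarith

theorem mul_pi_sub_le_sin {x : ℝ} (h0 : 0 ≤ x) (hπ : x ≤ π) :
    x * (π - x) ≤ π ^ 2 / 2 * Real.sin x := by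
  wlog hle : x ≤ π / 2 generalizing x
  · have h := this (x := π - x) (by linarith) (by linarith) (by linarith)
    rwa [Real.sin_pi_sub, sub_sub_cancel, mul_comm] at h
  calc x * (π - x) ≤ x * π := by gcongr; linarith
    _ = π ^ 2 / 2 * (2 / π * x) := by field_simp
    _ ≤ π ^ 2 / 2 * Real.sin x := by gcongr; exact Real.mul_le_sin h0 hle

theorem tangentDensity_le {p : ℝ → ℝ} (hp : PositivelyCurved p) {M : ℝ}
    (hM : ∀ φ, p φ + deriv (deriv p) φ < M) {z : ℝ × ℝ} (hz : z.1 ∈ Ioo 0 π) :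
    tangentDensity p z ≤ M ^ 2 * z.1 ^ 4 / 4 / Real.sin z.1 ^ 3 := by
  have hsin := Real.sin_pos_of_mem_Ioo hz
  have hM0 : 0 < M := (hp.curvature_pos 0).trans (hM 0)
  have hcos : M * (1 - Real.cos z.1) ≤ M * (z.1 ^ 2 / 2) := by
    gcongr
    linarith [Real.one_sub_sq_div_two_le_cos (x := z.1)]
  have hleft := (sin_mul_tangentLengthLeft_lt hp.contDiff hM hz).le.trans hcos
  have hright := (sin_mul_tangentLengthRight_lt hp.contDiff hM hz).le.trans hcos
  have hpos := tangentLengthRight_pos hp hz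
  calc tangentDensity p z
      = Real.sin z.1 * tangentLengthLeft p z * (Real.sin z.1 * tangentLengthRight p z) /
          Real.sin z.1 ^ 3 := by
        rw [tangentDensity]
        field_simp
    _ ≤ M * (z.1 ^ 2 / 2) * (M * (z.1 ^ 2 / 2)) / Real.sin z.1 ^ 3 := by gcongr
    _ = M ^ 2 * z.1 ^ 4 / 4 / Real.sin z.1 ^ 3 := by ring

theorem abs_tangentDensity_mul_angleFn_le {p : ℝ → ℝ} (hp : PositivelyCurved p) {M : ℝ}
    (hM : ∀ φ, p φ + deriv (deriv p) φ < M) {z : ℝ × ℝ} (hz : z.1 ∈ Ioo 0 π) :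
    |tangentDensity p z * angleFn (π - z.1)| ≤ M ^ 2 / 4 * π * (π ^ 2 / 2) ^ 3 := by
  have hsin := Real.sin_pos_of_mem_Ioo hz
  obtain ⟨hpos, hlt⟩ := id hz
  have hdensity : 0 < tangentDensity p z :=
    div_pos (mul_pos (tangentLengthLeft_pos hp hz) (tangentLengthRight_pos hp hz)) hsin
  have hcube : (z.1 * (π - z.1)) ^ 3 ≤ (π ^ 2 / 2 * Real.sin z.1) ^ 3 :=
    pow_le_pow_left₀ (mul_nonneg hpos.le (by linarith)) (mul_pi_sub_le_sin hpos.le hlt.le) 3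
  rw [abs_mul, abs_of_pos hdensity]
  calc tangentDensity p z * |angleFn (π - z.1)|
      ≤ M ^ 2 * z.1 ^ 4 / 4 / Real.sin z.1 ^ 3 * (π - z.1) ^ 3 := by
        gcongr
        · exact tangentDensity_le hp hM hz
        · exact abs_angleFn_le (by linarith) (by linarith)
    _ = M ^ 2 / 4 * z.1 * (z.1 * (π - z.1)) ^ 3 / Real.sin z.1 ^ 3 := by ring
    _ ≤ M ^ 2 / 4 * π * (π ^ 2 / 2 * Real.sin z.1) ^ 3 / Real.sin z.1 ^ 3 := by
        gcongr M ^ 2 / 4 * ?_ * ?_ / _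
    _ = M ^ 2 / 4 * π * (π ^ 2 / 2) ^ 3 := by field_simp

theorem volume_tangentDomain_lt_top : volume tangentDomain < ⊤ := by
  rw [tangentDomain, Measure.volume_eq_prod, Measure.prod_prod, Real.volume_Ioo, Real.volume_Ico]
  exact ENNReal.mul_lt_top ENNReal.ofReal_lt_top ENNReal.ofReal_lt_top

theorem continuousOn_tangentDensity {p : ℝ → ℝ} (hp : ContDiff ℝ 1 p) :
    ContinuousOn (tangentDensity p) tangentDomain := by
  have := hp.continuous
  have := hp.continuous_deriv_one
  have hne (z : ℝ × ℝ) (hz : z ∈ tangentDomain) := (sin_pos_of_mem_tangentDomain hz).ne'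
  unfold tangentDensity tangentLengthLeft tangentLengthRight footDist
  fun_prop (disch := assumption)

theorem integrableOn_tangentDensity_mul_angleFn {p : ℝ → ℝ} (hp : PositivelyCurved p)
    (hper : Function.Periodic p (2 * π)) :
    IntegrableOn (fun z => tangentDensity p z * angleFn (π - z.1)) tangentDomain := by
  obtain ⟨M, hM⟩ := exists_curvature_lt hp.contDiff hper
  have hcont : ContinuousOn (fun z => tangentDensity p z * angleFn (π - z.1)) tangentDomain :=
    (continuousOn_tangentDensity (hp.contDiff.of_le one_le_two)).mul
      (continuous_angleFn.comp (by fun_prop)).continuousOn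
  exact IntegrableOn.of_bound volume_tangentDomain_lt_top
    (hcont.aestronglyMeasurable measurableSet_tangentDomain) _
    (ae_restrict_of_forall_mem measurableSet_tangentDomain fun z hz =>
      abs_tangentDensity_mul_angleFn_le hp hM hz.1)

theorem IsStrictlyConvexC2.integrableOn_visualIntegrand {K : Set Plane}
    (hK : IsStrictlyConvexC2 K) : IntegrableOn (visualIntegrand K) Kᶜ :=
  (hK.integrableOn_visualAngle_iff angleFn).2
    (integrableOn_tangentDensity_mul_angleFn hK.positivelyCurved (supportFn_periodic K))

/-! ### Correlations over a period -/

/-- The cosine integral `∫ f(x) cos(n x) dx` over a period, without normalizing factor. -/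
noncomputable def cosCoeff (f : ℝ → ℝ) (n : ℤ) : ℝ :=
  ∫ x in (0 : ℝ)..(2 * π), f x * Real.cos (n * x)

/-- The sine integral `∫ f(x) sin(n x) dx` over a period, without normalizing factor. -/
noncomputable def sinCoeff (f : ℝ → ℝ) (n : ℤ) : ℝ :=
  ∫ x in (0 : ℝ)..(2 * π), f x * Real.sin (n * x)

/-- The correlation integral `∫ f(φ) g(φ + δ) dφ` over a period. -/
noncomputable def corr (f g : ℝ → ℝ) (δ : ℝ) : ℝ :=
  ∫ φ in (0 : ℝ)..(2 * π), f φ * g (φ + δ)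

theorem periodic_cos_int_mul (n : ℤ) : Function.Periodic (fun x => Real.cos (n * x)) (2 * π) := by
  intro x
  simp only [mul_add, Real.cos_add_int_mul_two_pi]

theorem periodic_sin_int_mul (n : ℤ) : Function.Periodic (fun x => Real.sin (n * x)) (2 * π) := by
  intro x
  simp only [mul_add, Real.sin_add_int_mul_two_pi]

theorem continuous_corr {f g : ℝ → ℝ} (hf : Continuous f) (hg : Continuous g) :
    Continuous (corr f g) :=
  intervalIntegral.continuous_parametric_intervalIntegral_of_continuous' (by fun_prop) _ _

theorem hasDerivAt_corr {f g : ℝ → ℝ} (hf : Continuous f) (hg : ContDiff ℝ 1 g) (δ : ℝ) :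
    HasDerivAt (corr f g) (corr f (deriv g) δ) δ := by
  have := hg.continuous
  have := hg.continuous_deriv_one
  obtain ⟨C, hC⟩ := (isCompact_Icc (a := (0 : ℝ)) (b := 2 * π)).prod
    (isCompact_closedBall δ 1) |>.exists_bound_of_continuousOn
    (f := fun z : ℝ × ℝ => f z.1 * deriv g (z.1 + z.2)) (by fun_prop)
  refine (intervalIntegral.hasDerivAt_integral_of_dominated_loc_of_deriv_le (𝕜 := ℝ)
    (F := fun δ φ => f φ * g (φ + δ)) (F' := fun δ φ => f φ * deriv g (φ + δ))
    (bound := fun _ => C) (s := Metric.closedBall δ 1) (Metric.closedBall_mem_nhds δ one_pos)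
    (.of_forall fun x => Continuous.aestronglyMeasurable (by fun_prop))
    (Continuous.intervalIntegrable (by fun_prop) _ _)
    (Continuous.aestronglyMeasurable (by fun_prop)) ?_ intervalIntegrable_const ?_).2
  · refine .of_forall fun φ hφ x hx => hC (φ, x) ⟨?_, hx⟩
    rw [uIoc_of_le (by positivity)] at hφ
    exact ⟨hφ.1.le, hφ.2⟩
  · refine .of_forall fun φ _ x _ => ?_
    exact ((hg.differentiable_one (φ + x)).hasDerivAt.comp_const_add φ x).const_mul (f φ)

theorem integral_comp_add_of_periodic {f : ℝ → ℝ} (hper : Function.Periodic f (2 * π)) (δ : ℝ) :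
    ∫ φ in (0 : ℝ)..(2 * π), f (φ + δ) = ∫ φ in (0 : ℝ)..(2 * π), f φ := by
  rw [intervalIntegral.integral_comp_add_right, zero_add, add_comm,
    hper.intervalIntegral_add_eq δ 0, zero_add]

theorem integral_mul_deriv_of_periodic {f g : ℝ → ℝ} (hf : ContDiff ℝ 1 f) (hg : ContDiff ℝ 1 g)
    (hfper : Function.Periodic f (2 * π)) (hgper : Function.Periodic g (2 * π)) :
    ∫ φ in (0 : ℝ)..(2 * π), f φ * deriv g φ = -∫ φ in (0 : ℝ)..(2 * π), deriv f φ * g φ := by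
  rw [intervalIntegral.integral_mul_deriv_eq_deriv_mul
    (fun x _ => (hf.differentiable_one x).hasDerivAt)
    (fun x _ => (hg.differentiable_one x).hasDerivAt)
    (hf.continuous_deriv_one.intervalIntegrable _ _)
    (hg.continuous_deriv_one.intervalIntegrable _ _),
    hfper.eq, hgper.eq, sub_self, zero_sub]

theorem corr_deriv_left {f g : ℝ → ℝ} (hf : ContDiff ℝ 1 f) (hg : ContDiff ℝ 1 g)
    (hfper : Function.Periodic f (2 * π)) (hgper : Function.Periodic g (2 * π)) (δ : ℝ) :
    corr (deriv f) g δ = -corr f (deriv g) δ := by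
  have hparts := integral_mul_deriv_of_periodic hf (g := fun φ => g (φ + δ))
    (hg.comp (contDiff_id.add contDiff_const)) hfper (hgper.add_const δ)
  simp only [deriv_comp_add_const] at hparts
  rw [corr, corr, hparts, neg_neg]

theorem corr_self_deriv_zero {f : ℝ → ℝ} (hf : ContDiff ℝ 1 f)
    (hper : Function.Periodic f (2 * π)) : corr f (deriv f) 0 = 0 := by
  have hleft := corr_deriv_left hf hf hper hper 0
  have hcomm : corr (deriv f) f 0 = corr f (deriv f) 0 := by simp only [corr, add_zero, mul_comm]
  linarith

theorem corr_self_two_pi_sub {f : ℝ → ℝ} (hper : Function.Periodic f (2 * π)) (δ : ℝ) :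
    corr f f (2 * π - δ) = corr f f δ := by
  have hshift := integral_comp_add_of_periodic (hper.mul (hper.add_const (2 * π - δ))) δ
  rw [corr, corr]
  refine hshift.symm.trans (intervalIntegral.integral_congr fun φ _ => ?_)
  simp only [Pi.mul_apply]
  rw [show φ + δ + (2 * π - δ) = φ + 2 * π by ring, hper, mul_comm]

theorem integral_cos_mul_comp_add {g : ℝ → ℝ} (hg : Continuous g)
    (hper : Function.Periodic g (2 * π)) (n : ℤ) (φ : ℝ) :
    ∫ δ in (0 : ℝ)..(2 * π), Real.cos (n * δ) * g (φ + δ) =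
      cosCoeff g n * Real.cos (n * φ) + sinCoeff g n * Real.sin (n * φ) := by
  have hshift := integral_comp_add_of_periodic (f := fun x => Real.cos (n * (x - φ)) * g x)
    (((periodic_cos_int_mul n).sub_const φ).mul hper) φ
  simp only [add_comm _ φ, add_sub_cancel_left] at hshift
  rw [hshift, cosCoeff, sinCoeff, ← intervalIntegral.integral_mul_const,
    ← intervalIntegral.integral_mul_const,
    ← intervalIntegral.integral_add (Continuous.intervalIntegrable (by fun_prop) _ _)
      (Continuous.intervalIntegrable (by fun_prop) _ _)]
  refine intervalIntegral.integral_congr fun x _ => ?_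
  simp only [mul_sub, Real.cos_sub]
  ring

theorem integral_cos_mul_corr {f g : ℝ → ℝ} (hf : Continuous f) (hg : Continuous g)
    (hper : Function.Periodic g (2 * π)) (n : ℤ) :
    ∫ δ in (0 : ℝ)..(2 * π), Real.cos (n * δ) * corr f g δ =
      cosCoeff f n * cosCoeff g n + sinCoeff f n * sinCoeff g n := by
  have hswap : ∫ δ in (0 : ℝ)..(2 * π), Real.cos (n * δ) * corr f g δ =
      ∫ φ in (0 : ℝ)..(2 * π), ∫ δ in (0 : ℝ)..(2 * π),
        Real.cos (n * δ) * (f φ * g (φ + δ)) := by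
    simp only [corr, ← intervalIntegral.integral_const_mul]
    refine intervalIntegral_intervalIntegral_swap ?_
    exact ((Continuous.continuousOn (by fun_prop)).integrableOn_compact
      (isCompact_uIcc.prod isCompact_uIcc)).mono_set
      (prod_mono uIoc_subset_uIcc uIoc_subset_uIcc)
  have hinner (φ : ℝ) : ∫ δ in (0 : ℝ)..(2 * π), Real.cos (n * δ) * (f φ * g (φ + δ)) =
      f φ * Real.cos (n * φ) * cosCoeff g n + f φ * Real.sin (n * φ) * sinCoeff g n := by
    simp only [mul_left_comm _ (f φ), intervalIntegral.integral_const_mul,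
      integral_cos_mul_comp_add hg hper]
    ring
  simp only [hswap, hinner]
  rw [intervalIntegral.integral_add (Continuous.intervalIntegrable (by fun_prop) _ _)
    (Continuous.intervalIntegrable (by fun_prop) _ _), intervalIntegral.integral_mul_const,
    intervalIntegral.integral_mul_const]
  rfl

theorem integral_eq_two_mul_of_reflection {F : ℝ → ℝ} (hF : Continuous F) {a : ℝ}
    (hrefl : ∀ x, F (2 * a - x) = F x) :
    ∫ x in (0 : ℝ)..(2 * a), F x = 2 * ∫ x in (0 : ℝ)..a, F x := by
  have hhalf : ∫ x in a..(2 * a), F x = ∫ x in (0 : ℝ)..a, F x := by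
    have hcomp := intervalIntegral.integral_comp_sub_left (a := 0) (b := a) F (2 * a)
    simp only [hrefl] at hcomp
    rw [hcomp]
    congr 1 <;> ring
  rw [← intervalIntegral.integral_add_adjacent_intervals (hF.intervalIntegrable 0 a)
    (hF.intervalIntegrable a (2 * a)), hhalf, two_mul]

theorem integral_cos_two_mul_corr {f : ℝ → ℝ} (hf : Continuous f)
    (hper : Function.Periodic f (2 * π)) :
    ∫ δ in (0 : ℝ)..π, Real.cos (2 * δ) * corr f f δ =
      (cosCoeff f 2 ^ 2 + sinCoeff f 2 ^ 2) / 2 := by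
  have hcorr := continuous_corr hf hf
  have hhalf := integral_eq_two_mul_of_reflection (a := π)
    (F := fun δ => Real.cos (2 * δ) * corr f f δ) (by fun_prop) fun δ => by
      rw [corr_self_two_pi_sub hper, mul_sub, ← mul_assoc, Real.cos_sub, mul_assoc,
        Real.cos_two_mul]
      norm_num [Real.sin_two_mul]
  have hfull := integral_cos_mul_corr hf hf hper 2
  push_cast at hfull
  linarith

/-! ### The integral over the exterior -/

/-- The correlation of `p` with itself, with its value at `0` removed by a multiple of `cos` so
that it vanishes to second order at `0`. -/
noncomputable def redCorr (p : ℝ → ℝ) (δ : ℝ) : ℝ := corr p p δ - corr p p 0 * Real.cos δ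

theorem hasDerivAt_redCorr {p : ℝ → ℝ} (hp : ContDiff ℝ 1 p) (δ : ℝ) :
    HasDerivAt (redCorr p) (corr p (deriv p) δ + corr p p 0 * Real.sin δ) δ :=
  ((hasDerivAt_corr hp.continuous hp δ).sub
    ((Real.hasDerivAt_cos δ).const_mul (corr p p 0))).congr_deriv (by ring)

theorem hasDerivAt_deriv_redCorr {p : ℝ → ℝ} (hp : ContDiff ℝ 2 p) (δ : ℝ) :
    HasDerivAt (fun δ => corr p (deriv p) δ + corr p p 0 * Real.sin δ)
      (corr p (deriv (deriv p)) δ + corr p p 0 * Real.cos δ) δ :=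
  (hasDerivAt_corr hp.continuous (contDiff_deriv_of_contDiff_two hp) δ).add
    ((Real.hasDerivAt_sin δ).const_mul (corr p p 0))

theorem integral_tangentLengthLeft_mul_tangentLengthRight {p : ℝ → ℝ} (hp : ContDiff ℝ 2 p)
    (hper : Function.Periodic p (2 * π)) {δ : ℝ} (hδ : Real.sin δ ≠ 0) :
    ∫ φ in (0 : ℝ)..(2 * π), tangentLengthLeft p (δ, φ) * tangentLengthRight p (δ, φ) =
      corr p (deriv (deriv p)) δ - 2 * Real.cos δ / Real.sin δ * corr p (deriv p) δ +
        ((1 + Real.cos δ ^ 2) * corr p p δ - 2 * Real.cos δ * corr p p 0) / Real.sin δ ^ 2 := by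
  have hp1 := hp.of_le one_le_two
  have := hp1.continuous
  have := hp1.continuous_deriv_one
  have hleft := corr_deriv_left hp1 hp1 hper hper δ
  have hleft' := corr_deriv_left hp1 (contDiff_deriv_of_contDiff_two hp) hper
    (deriv_periodic hper) δ
  have hzero := corr_self_deriv_zero hp1 hper
  have hshift := integral_comp_add_of_periodic (hper.mul hper) δ
  have hshift' := integral_comp_add_of_periodic (hper.mul (deriv_periodic hper)) δ
  simp only [corr, add_zero, Pi.mul_apply] at hleft hleft' hzero hshift hshift' ⊢
  have hexpand (φ : ℝ) : tangentLengthLeft p (δ, φ) * tangentLengthRight p (δ, φ) =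
      (1 + Real.cos δ ^ 2) / Real.sin δ ^ 2 * (p φ * p (φ + δ)) -
        Real.cos δ / Real.sin δ ^ 2 * (p φ * p φ) -
        Real.cos δ / Real.sin δ ^ 2 * (p (φ + δ) * p (φ + δ)) -
        Real.cos δ / Real.sin δ * (p φ * deriv p (φ + δ)) +
        Real.cos δ / Real.sin δ * (deriv p φ * p (φ + δ)) +
        1 / Real.sin δ * (p (φ + δ) * deriv p (φ + δ)) - 1 / Real.sin δ * (p φ * deriv p φ) -
        deriv p φ * deriv p (φ + δ) := by
    simp only [tangentLengthLeft, tangentLengthRight, footDist]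
    field_simp
    ring
  simp only [hexpand]
  rw [intervalIntegral.integral_sub, intervalIntegral.integral_sub, intervalIntegral.integral_add,
    intervalIntegral.integral_add, intervalIntegral.integral_sub, intervalIntegral.integral_sub,
    intervalIntegral.integral_sub]
  · simp only [intervalIntegral.integral_const_mul, hleft, hleft', hshift, hshift', hzero]
    field_simp
    ring
  all_goals exact Continuous.intervalIntegrable (by fun_prop) _ _

theorem deriv_angleFn :
    deriv angleFn = fun u => 1 - Real.cos u - 2 * Real.sin u ^ 2 * Real.cos u := by
  ext u
  refine ((((hasDerivAt_id' u).sub (Real.hasDerivAt_sin u)).sub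
    (((Real.hasDerivAt_sin u).fun_pow 3).const_mul (2 / 3))).congr_deriv ?_).deriv
  norm_num
  ring

theorem hasDerivAt_angleFn (u : ℝ) : HasDerivAt angleFn (deriv angleFn u) u := by
  refine DifferentiableAt.hasDerivAt ?_
  unfold angleFn
  fun_prop

theorem hasDerivAt_deriv_angleFn (u : ℝ) :
    HasDerivAt (deriv angleFn) (Real.sin u * (3 - 6 * Real.cos u ^ 2)) u := by
  rw [deriv_angleFn]
  refine (((Real.hasDerivAt_cos u).const_sub 1).sub
    ((((Real.hasDerivAt_sin u).fun_pow 2).const_mul 2).mul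
      (Real.hasDerivAt_cos u))).congr_deriv ?_
  norm_num
  linear_combination 2 * Real.sin u * Real.sin_sq_add_cos_sq u

section Limits

open Filter Topology

theorem tendsto_div_sin_zero {f : ℝ → ℝ} {a : ℝ} (hf : HasDerivAt f a 0) (h0 : f 0 = 0) :
    Tendsto (fun x => f x / Real.sin x) (𝓝[≠] 0) (𝓝 a) := by
  have hslope := (hasDerivAt_iff_tendsto_slope_zero.1 hf).div
    (hasDerivAt_iff_tendsto_slope_zero.1 (Real.hasDerivAt_sin 0)) (by simp)
  rw [Real.cos_zero, div_one] at hslope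
  refine hslope.congr' ?_
  filter_upwards [self_mem_nhdsWithin] with x hx
  have : x ≠ 0 := hx
  simp only [Pi.div_apply, zero_add, h0, Real.sin_zero, sub_zero, smul_eq_mul]
  field_simp

theorem tendsto_div_sin_sq_zero {f f' : ℝ → ℝ} {a : ℝ} (hf : ∀ x, HasDerivAt f (f' x) x)
    (hf' : HasDerivAt f' a 0) (h0 : f 0 = 0) (h0' : f' 0 = 0) :
    Tendsto (fun x => f x / Real.sin x ^ 2) (𝓝[≠] 0) (𝓝 (a / 2)) := by
  have hcos : Tendsto (fun x => 2 * Real.cos x) (𝓝 0) (𝓝 2) := by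
    simpa using (Real.continuous_cos.tendsto 0).const_mul 2
  have hne : ∀ᶠ x in 𝓝[≠] (0 : ℝ), 2 * Real.sin x * Real.cos x ≠ 0 := by
    filter_upwards [(hcos.mono_left nhdsWithin_le_nhds).eventually_ne two_ne_zero,
      (Real.hasDerivAt_sin 0).eventually_ne (c := 0) (by simp)] with x hcosx hsinx
    rw [mul_right_comm]
    exact mul_ne_zero hcosx hsinx
  refine HasDerivAt.lhopital_zero_nhdsNE (.of_forall hf)
    (g' := fun x => 2 * Real.sin x * Real.cos x)
    (.of_forall fun x => by simpa using (Real.hasDerivAt_sin x).fun_pow 2) hne ?_ ?_ ?_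
  · simpa only [h0] using (hf 0).continuousAt.tendsto.mono_left nhdsWithin_le_nhds
  · simpa using ((Real.continuous_sin.tendsto 0).pow 2).mono_left nhdsWithin_le_nhds
  · refine ((tendsto_div_sin_zero hf' h0').div (hcos.mono_left nhdsWithin_le_nhds)
      two_ne_zero).congr fun x => ?_
    simp only [Pi.div_apply, div_div]
    ring

theorem tendsto_pi_sub : Tendsto (fun x => π - x) (𝓝[<] π) (𝓝[≠] 0) := by
  refine tendsto_nhdsWithin_iff.2 ⟨?_, ?_⟩
  · simpa using (tendsto_id.const_sub π).mono_left (nhdsWithin_le_nhds (s := Iio π) (a := π))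
  · filter_upwards [self_mem_nhdsWithin] with x hx
    exact (sub_pos.2 hx).ne'

theorem tendsto_deriv_angleFn_pi_sub_div_sin :
    Tendsto (fun x => deriv angleFn (π - x) / Real.sin x) (𝓝[<] π) (𝓝 0) := by
  have hlim := tendsto_div_sin_zero (hasDerivAt_deriv_angleFn 0) (by simp [deriv_angleFn])
  simpa [Function.comp_def] using hlim.comp tendsto_pi_sub

theorem tendsto_angleFn_pi_sub_div_sin_sq :
    Tendsto (fun x => angleFn (π - x) / Real.sin x ^ 2) (𝓝[<] π) (𝓝 0) := by
  have hlim := tendsto_div_sin_sq_zero hasDerivAt_angleFn (hasDerivAt_deriv_angleFn 0)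
    (by simp [angleFn]) (by simp [deriv_angleFn])
  simpa [Function.comp_def] using hlim.comp tendsto_pi_sub

end Limits

section IntegrationByParts

variable {V V' V'' : ℝ → ℝ}

theorem hasDerivAt_div_sin {x : ℝ} (hV : HasDerivAt V (V' x) x) (hx : Real.sin x ≠ 0) :
    HasDerivAt (fun t => V t / Real.sin t)
      (V' x / Real.sin x - V x * Real.cos x / Real.sin x ^ 2) x :=
  (hV.fun_div (Real.hasDerivAt_sin x) hx).congr_deriv (by field_simp)

theorem hasDerivAt_deriv_div_sin {x : ℝ} (hV : HasDerivAt V (V' x) x)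
    (hV' : HasDerivAt V' (V'' x) x) (hx : Real.sin x ≠ 0) :
    HasDerivAt (fun t => V' t / Real.sin t - V t * Real.cos t / Real.sin t ^ 2)
      (V'' x / Real.sin x - 2 * V' x * Real.cos x / Real.sin x ^ 2 +
        V x * (1 + Real.cos x ^ 2) / Real.sin x ^ 3) x := by
  have hsin := Real.hasDerivAt_sin x
  refine ((hV'.fun_div hsin hx).fun_sub ((hV.fun_mul (Real.hasDerivAt_cos x)).fun_div
    (hsin.fun_pow 2) (pow_ne_zero 2 hx))).congr_deriv ?_
  norm_num
  field_simp
  linear_combination V x * Real.sin_sq_add_cos_sq x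

theorem hasDerivAt_by_parts_primitive {J : ℝ → ℝ} {x : ℝ} (hV : HasDerivAt V (V' x) x)
    (hV' : HasDerivAt V' (V'' x) x) (hJ : HasDerivAt J ((3 - 6 * Real.cos x ^ 2) * V x) x)
    (hx : Real.sin x ≠ 0) :
    HasDerivAt (fun t => angleFn (π - t) * (V' t / Real.sin t - V t * Real.cos t / Real.sin t ^ 2) +
        deriv angleFn (π - t) * (V t / Real.sin t) + J t)
      (angleFn (π - x) * (V'' x / Real.sin x - 2 * V' x * Real.cos x / Real.sin x ^ 2 +
        V x * (1 + Real.cos x ^ 2) / Real.sin x ^ 3)) x := by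
  have hangle := (hasDerivAt_angleFn (π - x)).comp_const_sub π x
  have hangle' := (hasDerivAt_deriv_angleFn (π - x)).comp_const_sub π x
  refine (((hangle.fun_mul (hasDerivAt_deriv_div_sin hV hV' hx)).fun_add
    (hangle'.fun_mul (hasDerivAt_div_sin hV hx))).fun_add hJ).congr_deriv ?_
  rw [Real.sin_pi_sub, Real.cos_pi_sub]
  field_simp
  ring

open Filter Topology in
theorem tendsto_deriv_div_sin_zero (hV : ∀ x, HasDerivAt V (V' x) x)
    (hV' : ∀ x, HasDerivAt V' (V'' x) x) (h0 : V 0 = 0) (h0' : V' 0 = 0) :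
    Tendsto (fun x => V' x / Real.sin x - V x * Real.cos x / Real.sin x ^ 2) (𝓝[≠] 0)
      (𝓝 (V'' 0 / 2)) := by
  have hcos := (Real.continuous_cos.tendsto 0).mono_left (nhdsWithin_le_nhds (s := {0}ᶜ))
  have hlim := (tendsto_div_sin_zero (hV' 0) h0').sub
    ((tendsto_div_sin_sq_zero hV (hV' 0) h0 h0').mul hcos)
  rw [Real.cos_zero, mul_one, sub_half] at hlim
  exact hlim.congr fun x => by ring

open Filter Topology in
theorem integral_angleFn_mul_deriv_deriv_div_sin (hV : ∀ x, HasDerivAt V (V' x) x)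
    (hV' : ∀ x, HasDerivAt V' (V'' x) x) (h0 : V 0 = 0) (h0' : V' 0 = 0)
    (hintegrable : IntervalIntegrable (fun δ => angleFn (π - δ) * (V'' δ / Real.sin δ -
      2 * V' δ * Real.cos δ / Real.sin δ ^ 2 + V δ * (1 + Real.cos δ ^ 2) / Real.sin δ ^ 3))
      volume 0 π) :
    ∫ δ in (0 : ℝ)..π, angleFn (π - δ) * (V'' δ / Real.sin δ -
      2 * V' δ * Real.cos δ / Real.sin δ ^ 2 + V δ * (1 + Real.cos δ ^ 2) / Real.sin δ ^ 3) =
    (∫ δ in (0 : ℝ)..π, (3 - 6 * Real.cos δ ^ 2) * V δ) - π / 2 * V'' 0 := by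
  have hVc : Continuous V := continuous_iff_continuousAt.2 fun x => (hV x).continuousAt
  have hVc' : Continuous V' := continuous_iff_continuousAt.2 fun x => (hV' x).continuousAt
  have hsin {x : ℝ} (hx : x ∈ Ioo 0 π) : Real.sin x ≠ 0 := (Real.sin_pos_of_mem_Ioo hx).ne'
  set J : ℝ → ℝ := fun x => ∫ δ in (0 : ℝ)..x, (3 - 6 * Real.cos δ ^ 2) * V δ with hJ
  have hJderiv (x : ℝ) : HasDerivAt J ((3 - 6 * Real.cos x ^ 2) * V x) x :=
    intervalIntegral.integral_hasDerivAt_right (Continuous.intervalIntegrable (by fun_prop) _ _)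
      (Continuous.stronglyMeasurableAtFilter (by fun_prop) _ _) (by fun_prop)
  have hg (x : ℝ) : ContinuousAt (fun x => angleFn (π - x)) x :=
    ((hasDerivAt_angleFn (π - x)).comp_const_sub π x).continuousAt
  have hg' (x : ℝ) : ContinuousAt (fun x => deriv angleFn (π - x)) x :=
    ((hasDerivAt_deriv_angleFn (π - x)).comp_const_sub π x).continuousAt
  have hzero := ((((hg 0).tendsto.mono_left nhdsWithin_le_nhds).mul
    (tendsto_deriv_div_sin_zero hV hV' h0 h0')).add
    (((hg' 0).tendsto.mono_left nhdsWithin_le_nhds).mul (tendsto_div_sin_zero (hV 0) h0))).add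
    ((hJderiv 0).continuousAt.tendsto.mono_left nhdsWithin_le_nhds)
  have hpi := ((tendsto_angleFn_pi_sub_div_sin_sq.mul
    ((show Continuous fun x => V' x * Real.sin x - V x * Real.cos x by fun_prop).tendsto' π _
      rfl |>.mono_left nhdsWithin_le_nhds)).add
    (tendsto_deriv_angleFn_pi_sub_div_sin.mul
      ((hVc.tendsto π).mono_left nhdsWithin_le_nhds))).add
    ((hJderiv π).continuousAt.tendsto.mono_left nhdsWithin_le_nhds)
  rw [intervalIntegral.integral_eq_sub_of_hasDerivAt_of_tendsto Real.pi_pos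
    (fun x hx => hasDerivAt_by_parts_primitive (hV x) (hV' x) (hJderiv x) (hsin hx)) hintegrable
    (hzero.mono_left (nhdsGT_le_nhdsNE 0)) (hpi.congr' ?_)]
  · simp only [hJ, h0', angleFn, intervalIntegral.integral_same, Real.sin_pi, Real.cos_pi, sub_zero]
    ring
  · filter_upwards [Ioo_mem_nhdsLT Real.pi_pos] with x hx
    have := hsin hx
    field_simp

end IntegrationByParts

theorem integral_tangentDensity_slice {p : ℝ → ℝ} (hp : ContDiff ℝ 2 p)
    (hper : Function.Periodic p (2 * π)) {δ : ℝ} (hδ : δ ∈ Ioo 0 π) :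
    ∫ φ in Ico 0 (2 * π), tangentDensity p (δ, φ) * angleFn (π - δ) =
      angleFn (π - δ) * ((corr p (deriv (deriv p)) δ + corr p p 0 * Real.cos δ) / Real.sin δ -
        2 * (corr p (deriv p) δ + corr p p 0 * Real.sin δ) * Real.cos δ / Real.sin δ ^ 2 +
        redCorr p δ * (1 + Real.cos δ ^ 2) / Real.sin δ ^ 3) := by
  have hsin : Real.sin δ ≠ 0 := (Real.sin_pos_of_mem_Ioo hδ).ne'
  simp only [tangentDensity]
  rw [integral_Ico_eq_integral_Ioc, ← intervalIntegral.integral_of_le (by positivity),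
    intervalIntegral.integral_mul_const, intervalIntegral.integral_div,
    integral_tangentLengthLeft_mul_tangentLengthRight hp hper hsin, redCorr]
  field_simp
  linear_combination angleFn (π - δ) * corr p p 0 * Real.cos δ * Real.sin_sq_add_cos_sq δ

theorem integral_cos_sub_two_mul_cos_cube :
    ∫ δ in (0 : ℝ)..π, (Real.cos δ - 2 * Real.cos δ ^ 3) = 0 := by
  have hderiv (x : ℝ) : HasDerivAt (fun t => 2 / 3 * Real.sin t ^ 3 - Real.sin t)
      (Real.cos x - 2 * Real.cos x ^ 3) x := by
    refine ((((Real.hasDerivAt_sin x).fun_pow 3).const_mul (2 / 3)).fun_sub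
      (Real.hasDerivAt_sin x)).congr_deriv ?_
    norm_num
    linear_combination 2 * Real.cos x * Real.sin_sq_add_cos_sq x
  rw [intervalIntegral.integral_eq_sub_of_hasDerivAt (fun x _ => hderiv x)
    (Continuous.intervalIntegrable (by fun_prop) _ _)]
  simp

theorem integral_mul_redCorr {p : ℝ → ℝ} (hp : Continuous p)
    (hper : Function.Periodic p (2 * π)) :
    ∫ δ in (0 : ℝ)..π, (3 - 6 * Real.cos δ ^ 2) * redCorr p δ =
      -(3 / 2) * (cosCoeff p 2 ^ 2 + sinCoeff p 2 ^ 2) := by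
  have := continuous_corr hp hp
  have hsplit (δ : ℝ) : (3 - 6 * Real.cos δ ^ 2) * redCorr p δ =
      -3 * (Real.cos (2 * δ) * corr p p δ) +
        -3 * corr p p 0 * (Real.cos δ - 2 * Real.cos δ ^ 3) := by
    rw [redCorr, Real.cos_two_mul]
    ring
  simp only [hsplit]
  rw [intervalIntegral.integral_add (Continuous.intervalIntegrable (by fun_prop) _ _)
    (Continuous.intervalIntegrable (by fun_prop) _ _), intervalIntegral.integral_const_mul,
    intervalIntegral.integral_const_mul, integral_cos_sub_two_mul_cos_cube,
    integral_cos_two_mul_corr hp hper]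
  ring

theorem setIntegral_tangentDensity_mul_angleFn {p : ℝ → ℝ} (hp : PositivelyCurved p)
    (hper : Function.Periodic p (2 * π)) :
    ∫ z in tangentDomain, tangentDensity p z * angleFn (π - z.1) =
      -(3 / 2) * (cosCoeff p 2 ^ 2 + sinCoeff p 2 ^ 2) -
        π / 2 * ∫ φ in (0 : ℝ)..(2 * π), p φ * (p φ + deriv (deriv p) φ) := by
  have hp1 := hp.contDiff.of_le one_le_two
  have := hp1.continuous
  have := continuous_deriv_deriv_of_contDiff_two hp.contDiff
  have hslice (δ : ℝ) (hδ : δ ∈ Ioo 0 π) := integral_tangentDensity_slice hp.contDiff hper hδ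
  have hintegrable := integrableOn_tangentDensity_mul_angleFn hp hper
  rw [tangentDomain, Measure.volume_eq_prod] at hintegrable ⊢
  have hzero : corr p (deriv (deriv p)) 0 + corr p p 0 * Real.cos 0 =
      ∫ φ in (0 : ℝ)..(2 * π), p φ * (p φ + deriv (deriv p) φ) := by
    simp only [corr, add_zero, Real.cos_zero, mul_one, mul_add]
    rw [add_comm, intervalIntegral.integral_add (Continuous.intervalIntegrable (by fun_prop) _ _)
      (Continuous.intervalIntegrable (by fun_prop) _ _)]
  rw [setIntegral_prod _ hintegrable, setIntegral_congr_fun measurableSet_Ioo hslice,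
    ← integral_Ioc_eq_integral_Ioo, ← intervalIntegral.integral_of_le Real.pi_pos.le,
    integral_angleFn_mul_deriv_deriv_div_sin (hasDerivAt_redCorr hp1)
      (hasDerivAt_deriv_redCorr hp.contDiff), integral_mul_redCorr hp1.continuous hper, hzero]
  · simp [redCorr]
  · simp [corr_self_deriv_zero hp1 hper]
  · rw [intervalIntegrable_iff_integrableOn_Ioo_of_le Real.pi_pos.le]
    rw [IntegrableOn, ← Measure.prod_restrict] at hintegrable
    exact IntegrableOn.congr_fun hintegrable.integral_prod_left hslice measurableSet_Ioo

theorem IsStrictlyConvexC2.integral_visualIntegrand {K : Set Plane}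
    (hK : IsStrictlyConvexC2 K) :
    ∫ P in Kᶜ, visualIntegrand K P =
      -(3 / 2) * (cosCoeff (supportFn K) 2 ^ 2 + sinCoeff (supportFn K) 2 ^ 2) -
        π / 2 * ∫ φ in (0 : ℝ)..(2 * π),
          supportFn K φ * (supportFn K φ + deriv (deriv (supportFn K)) φ) :=
  (hK.setIntegral_visualAngle angleFn).trans
    (setIntegral_tangentDensity_mul_angleFn hK.positivelyCurved (supportFn_periodic K))

/-! ### Boundary, area and length -/

theorem hasDerivAt_normalVec (φ : ℝ) : HasDerivAt normalVec (tangentVec φ) φ := by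
  rw [hasDerivAt_iff_hasFDerivAt, ← hasFDerivWithinAt_univ, hasFDerivWithinAt_euclidean]
  intro i
  rw [hasFDerivWithinAt_univ]
  fin_cases i
  · exact (Real.hasDerivAt_cos φ).hasFDerivAt.congr_fderiv (by ext; simp [tangentVec])
  · exact (Real.hasDerivAt_sin φ).hasFDerivAt.congr_fderiv (by ext; simp [tangentVec])

theorem hasDerivAt_tangentVec (φ : ℝ) : HasDerivAt tangentVec (-normalVec φ) φ := by
  rw [hasDerivAt_iff_hasFDerivAt, ← hasFDerivWithinAt_univ, hasFDerivWithinAt_euclidean]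
  intro i
  rw [hasFDerivWithinAt_univ]
  fin_cases i
  · exact (Real.hasDerivAt_sin φ).neg.hasFDerivAt.congr_fderiv (by ext; simp [normalVec])
  · exact (Real.hasDerivAt_cos φ).hasFDerivAt.congr_fderiv (by ext; simp [normalVec])

theorem hasDerivAt_envelope {f : ℝ → ℝ} (hf : ContDiff ℝ 2 f) (t : ℝ) :
    HasDerivAt (envelope f) ((f t + deriv (deriv f) t) • tangentVec t) t := by
  refine (((hasDerivAt_of_contDiff_two hf t).smul (hasDerivAt_normalVec t)).add
    ((hasDerivAt_deriv_of_contDiff_two hf t).smul (hasDerivAt_tangentVec t))).congr_deriv ?_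
  module

theorem hasDerivAt_envelope_apply {f : ℝ → ℝ} (hf : ContDiff ℝ 2 f) (i : Fin 2) (t : ℝ) :
    HasDerivAt (fun t => envelope f t i) ((f t + deriv (deriv f) t) * tangentVec t i) t :=
  (EuclideanSpace.proj (𝕜 := ℝ) i).hasFDerivAt.comp_hasDerivAt t (hasDerivAt_envelope hf t)

theorem inter_frontier_nonempty_of_isPreconnected {X : Type*} [TopologicalSpace X] {s t : Set X}
    (ht : IsPreconnected t) (hinter : (t ∩ s).Nonempty) (hdiff : (t \ s).Nonempty) :
    (t ∩ frontier s).Nonempty := by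
  by_contra! hempty
  have hfrontier (x : X) (hx : x ∈ t) : x ∉ frontier s := fun h =>
    Set.notMem_empty x (hempty ▸ ⟨hx, h⟩)
  have hcover : t ⊆ interior s ∪ (closure s)ᶜ := fun x hx => by
    by_contra! h
    rw [mem_union, not_or, mem_compl_iff, not_not] at h
    exact hfrontier x hx ⟨h.2, h.1⟩
  obtain ⟨x, hx, hxs⟩ := hinter
  obtain ⟨y, hy, hys⟩ := hdiff
  obtain ⟨z, -, hz, hz'⟩ := ht _ _ isOpen_interior isClosed_closure.isOpen_compl hcover
    ⟨x, hx, by_contra fun h => hfrontier x hx ⟨subset_closure hxs, h⟩⟩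
    ⟨y, hy, fun h => hfrontier y hy ⟨h, fun h' => hys (interior_subset h')⟩⟩
  exact hz' (subset_closure (interior_subset hz))

theorem exists_frontier_lineMap_eq {E : Type*} [NormedAddCommGroup E] [NormedSpace ℝ E]
    {s : Set E} (hs : Bornology.IsBounded s) {x y : E} (hy : y ∈ s) (hne : y ≠ x) :
    ∃ z ∈ frontier s, ∃ r ∈ Ioc (0 : ℝ) 1, AffineMap.lineMap x z r = y := by
  have hray : IsPreconnected (AffineMap.lineMap x y '' Ici (1 : ℝ)) :=
    isPreconnected_Ici.image _ AffineMap.lineMap_continuous.continuousOn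
  have hinter : (AffineMap.lineMap x y '' Ici (1 : ℝ) ∩ s).Nonempty :=
    ⟨y, ⟨1, self_mem_Ici, AffineMap.lineMap_apply_one x y⟩, hy⟩
  have hdiff : (AffineMap.lineMap x y '' Ici (1 : ℝ) \ s).Nonempty := by
    obtain ⟨R, hR⟩ := hs.subset_closedBall x
    have hdist : 0 < dist x y := dist_pos.2 hne.symm
    refine ⟨_, mem_image_of_mem _ (le_max_left 1 (R / dist x y + 1)), fun hmem => ?_⟩
    have hle := hR hmem
    rw [Metric.mem_closedBall, dist_lineMap_left, ← le_div_iff₀ hdist, Real.norm_eq_abs] at hle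
    linarith [le_abs_self (max 1 (R / dist x y + 1)), le_max_right 1 (R / dist x y + 1)]
  obtain ⟨_, ⟨l, hl, rfl⟩, hz⟩ := inter_frontier_nonempty_of_isPreconnected hray hinter hdiff
  have hl0 : 0 < l := zero_lt_one.trans_le hl
  refine ⟨_, hz, l⁻¹, ⟨inv_pos.2 hl0, inv_le_one_of_one_le₀ hl⟩, ?_⟩
  rw [AffineMap.lineMap_lineMap_right, inv_mul_cancel₀ hl0.ne', AffineMap.lineMap_apply_one]

section Cone

variable {p : ℝ → ℝ}

/-- The point at ratio `z.1` on the segment from the point with parameter `0` to the point with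
parameter `z.2` of the curve with generalized support function `p`. -/
noncomputable def coneMap (p : ℝ → ℝ) (z : ℝ × ℝ) : Plane :=
  AffineMap.lineMap (envelope p 0) (envelope p z.2) z.1

theorem coneMap_eq (z : ℝ × ℝ) :
    coneMap p z = envelope p 0 + z.1 • (envelope p z.2 - envelope p 0) := by
  rw [coneMap, AffineMap.lineMap_apply_module', add_comm]

theorem hasFDerivAt_coneMap (hp : ContDiff ℝ 2 p) (i : Fin 2) (z : ℝ × ℝ) :
    HasFDerivAt (fun z => coneMap p z i) (linearForm (envelope p z.2 i - envelope p 0 i)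
      (z.1 * ((p z.2 + deriv (deriv p) z.2) * tangentVec z.2 i))) z := by
  have henv : HasFDerivAt (fun z : ℝ × ℝ => envelope p z.2 i)
      (((p z.2 + deriv (deriv p) z.2) * tangentVec z.2 i) • ContinuousLinearMap.snd ℝ ℝ ℝ) z :=
    (hasDerivAt_envelope_apply hp i z.2).comp_hasFDerivAt z hasFDerivAt_snd
  simp only [coneMap_eq, PiLp.add_apply, PiLp.smul_apply, PiLp.sub_apply, smul_eq_mul]
  refine ((hasFDerivAt_fst.mul (henv.sub_const (envelope p 0 i))).const_add
    (envelope p 0 i)).congr_fderiv ?_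
  ext <;> simp [linearForm]

/-- The parameters `(r, φ)` whose segments sweep out the set bounded by the curve, except for the
apex `envelope p 0`. -/
def coneDomain : Set (ℝ × ℝ) := Ioc 0 1 ×ˢ Ioo 0 (2 * π)

theorem measurableSet_coneDomain : MeasurableSet coneDomain :=
  measurableSet_Ioc.prod measurableSet_Ioo

theorem inner_envelope_sub_normalVec_self (P : Plane) (φ : ℝ) :
    inner ℝ (envelope p φ - P) (normalVec φ) = gap p P φ := by
  rw [inner_sub_left, inner_envelope_normalVec_self, gap]

theorem PositivelyCurved.gap_envelope_zero_pos (hp : PositivelyCurved p)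
    (hper : Function.Periodic p (2 * π)) {φ : ℝ} (hφ : φ ∈ Ioo 0 (2 * π)) :
    0 < gap p (envelope p 0) φ :=
  hp.gap_envelope_pos hper (by rwa [zero_add])

theorem PositivelyCurved.abs_jacobian_coneMap (hp : PositivelyCurved p)
    (hper : Function.Periodic p (2 * π)) {z : ℝ × ℝ} (hz : z ∈ coneDomain) :
    |(envelope p z.2 0 - envelope p 0 0) *
          (z.1 * ((p z.2 + deriv (deriv p) z.2) * tangentVec z.2 1)) -
        z.1 * ((p z.2 + deriv (deriv p) z.2) * tangentVec z.2 0) *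
          (envelope p z.2 1 - envelope p 0 1)| =
      z.1 * ((p z.2 + deriv (deriv p) z.2) * gap p (envelope p 0) z.2) := by
  rw [← abs_of_pos (mul_pos hz.1.1
    (mul_pos (hp.curvature_pos z.2) (hp.gap_envelope_zero_pos hper hz.2))),
    ← inner_envelope_sub_normalVec_self, inner_normalVec]
  simp only [tangentVec, PiLp.sub_apply, Matrix.cons_val_zero, Matrix.cons_val_one]
  ring_nf

end Cone

theorem integral_mul_gap_eq {p : ℝ → ℝ} (hp : ContDiff ℝ 2 p)
    (hper : Function.Periodic p (2 * π)) (P : Plane) :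
    ∫ φ in (0 : ℝ)..(2 * π), (p φ + deriv (deriv p) φ) * gap p P φ =
      ∫ φ in (0 : ℝ)..(2 * π), p φ * (p φ + deriv (deriv p) φ) := by
  have hprimitive (φ : ℝ) : HasDerivAt
      (fun t => deriv p t * inner ℝ P (normalVec t) - p t * inner ℝ P (tangentVec t))
      ((p φ + deriv (deriv p) φ) * inner ℝ P (normalVec φ)) φ :=
    (((hasDerivAt_deriv_of_contDiff_two hp φ).fun_mul (hasDerivAt_inner_normalVec P φ)).fun_sub
      ((hasDerivAt_of_contDiff_two hp φ).fun_mul (hasDerivAt_inner_tangentVec P φ))).congr_deriv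
      (by ring)
  have := hp.continuous
  have := continuous_deriv_deriv_of_contDiff_two hp
  have := (contDiff_inner_normalVec P 0).continuous
  have : Continuous (gap p P) := hp.continuous.sub (contDiff_inner_normalVec P 0).continuous
  have hlinear : ∫ φ in (0 : ℝ)..(2 * π),
      (p φ + deriv (deriv p) φ) * inner ℝ P (normalVec φ) = 0 := by
    rw [intervalIntegral.integral_eq_sub_of_hasDerivAt (fun φ _ => hprimitive φ)
      (Continuous.intervalIntegrable (by fun_prop) _ _), sub_eq_zero]
    simp only [hper.eq, (deriv_periodic hper).eq, normalVec_periodic.eq, tangentVec_periodic.eq]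
  rw [← sub_eq_zero, ← intervalIntegral.integral_sub, ← neg_eq_zero,
    ← intervalIntegral.integral_neg, ← hlinear]
  · congr 1
    ext φ
    rw [gap]
    ring
  all_goals exact Continuous.intervalIntegrable (by fun_prop) _ _

namespace IsStrictlyConvexC2

variable {K : Set Plane} (hK : IsStrictlyConvexC2 K)
include hK

theorem mem_interior_of_gap_pos {x : Plane} (h : ∀ φ, 0 < gap (supportFn K) x φ) :
    x ∈ interior K := by
  have hpi : (0 : ℝ) < 2 * π := Real.two_pi_pos
  have hper := gap_periodic (supportFn_periodic K) x
  obtain ⟨φ₀, -, hmin⟩ := isCompact_Icc.exists_isMinOn (nonempty_Icc.2 hpi.le)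
    ((hK.positivelyCurved.gap x).contDiff.continuous.continuousOn (s := Icc 0 (2 * π)))
  refine mem_interior_iff_mem_nhds.2 (Metric.mem_nhds_iff.2 ⟨_, h φ₀, fun y hy =>
    (hK.mem_iff_gap_nonneg y).2 fun φ => ?_⟩)
  obtain ⟨ψ, hψ, hφψ⟩ := hper.exists_mem_Ico₀ hpi φ
  have hle : gap (supportFn K) x φ₀ ≤ gap (supportFn K) x φ :=
    hφψ ▸ hmin (Ico_subset_Icc_self hψ)
  have hcauchy : inner ℝ (y - x) (normalVec φ) ≤ ‖y - x‖ := by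
    simpa [norm_normalVec] using real_inner_le_norm (y - x) (normalVec φ)
  rw [inner_sub_left] at hcauchy
  rw [Metric.mem_ball, dist_eq_norm] at hy
  unfold gap at *
  linarith

theorem exists_eq_envelope_of_notMem_interior {x : Plane} (hx : x ∈ K) (hi : x ∉ interior K) :
    ∃ φ, x = envelope (supportFn K) φ := by
  by_contra! hne
  refine hi (hK.mem_interior_of_gap_pos fun φ => ?_)
  exact lt_of_le_of_ne ((hK.mem_iff_gap_nonneg x).1 hx φ) fun h0 =>
    hne φ (hK.eq_envelope hx (sub_eq_zero.1 h0.symm).symm)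

theorem envelope_notMem_interior (φ : ℝ) : envelope (supportFn K) φ ∉ interior K := by
  rw [mem_interior_iff_mem_nhds, Metric.mem_nhds_iff]
  rintro ⟨ε, hε, hball⟩
  have hmem : envelope (supportFn K) φ + (ε / 2) • normalVec φ ∈ K := by
    apply hball
    rw [Metric.mem_ball, dist_eq_norm, add_sub_cancel_left, norm_smul, norm_normalVec, mul_one,
      Real.norm_eq_abs, abs_of_pos (half_pos hε)]
    exact half_lt_self hε
  have hle := inner_le_supportFn hK.isCompact hmem φ
  rw [inner_add_left, inner_envelope_normalVec_self, real_inner_smul_left,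
    real_inner_self_eq_norm_sq, norm_normalVec] at hle
  linarith

theorem frontier_eq : frontier K = range (envelope (supportFn K)) := by
  rw [hK.isCompact.isClosed.frontier_eq]
  ext x
  constructor
  · rintro ⟨hx, hi⟩
    obtain ⟨φ, rfl⟩ := hK.exists_eq_envelope_of_notMem_interior hx hi
    exact mem_range_self φ
  · rintro ⟨φ, rfl⟩
    exact ⟨hK.envelope_mem φ, hK.envelope_notMem_interior φ⟩

theorem coneMap_injOn : InjOn (coneMap (supportFn K)) coneDomain := by
  set γ := envelope (supportFn K) with hγ
  have hper := supportFn_periodic K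
  have hle (r r' φ φ' : ℝ) (hr : 0 < r) (hφ' : φ' ∈ Ioo 0 (2 * π))
      (heq : r • (γ φ - γ 0) = r' • (γ φ' - γ 0)) : r' ≤ r := by
    have hpos := hK.positivelyCurved.gap_envelope_zero_pos hper hφ'
    have hinner := congrArg (fun x => inner ℝ x (normalVec φ')) heq
    have hsupp := inner_le_supportFn hK.isCompact (hK.envelope_mem φ) φ'
    simp only [real_inner_smul_left] at hinner
    rw [hγ, inner_envelope_sub_normalVec_self, inner_sub_left] at hinner
    refine le_of_mul_le_mul_right ?_ hpos
    rw [← hinner, gap]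
    gcongr
  rintro ⟨r, φ⟩ ⟨hr, hφ⟩ ⟨r', φ'⟩ ⟨hr', hφ'⟩ heq
  rw [coneMap_eq, coneMap_eq, add_right_inj] at heq
  obtain rfl : r = r' := le_antisymm (hle _ _ _ _ hr'.1 hφ heq.symm) (hle _ _ _ _ hr.1 hφ' heq)
  have hγφ : γ φ = γ φ' := sub_left_injective (smul_right_injective _ hr.1.ne' heq)
  rw [hK.positivelyCurved.envelope_injOn hper 0 (by rw [zero_add]; exact Ioo_subset_Ico_self hφ)
    (by rw [zero_add]; exact Ioo_subset_Ico_self hφ') hγφ]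

theorem image_coneMap :
    coneMap (supportFn K) '' coneDomain = K \ {envelope (supportFn K) 0} := by
  have hper := supportFn_periodic K
  ext x
  constructor
  · rintro ⟨⟨r, φ⟩, ⟨hr, hφ⟩, rfl⟩
    refine ⟨hK.convex.lineMap_mem (hK.envelope_mem 0) (hK.envelope_mem φ) (Ioc_subset_Icc_self hr),
      fun heq => ?_⟩
    rw [mem_singleton_iff, coneMap, AffineMap.lineMap_eq_left_iff] at heq
    have hpos := hK.positivelyCurved.gap_envelope_zero_pos hper hφ
    rw [heq.resolve_right hr.1.ne', gap, inner_envelope_normalVec_self, sub_self] at hpos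
    exact lt_irrefl 0 hpos
  · rintro ⟨hx, hne⟩
    obtain ⟨y, hy, r, hr, rfl⟩ := exists_frontier_lineMap_eq hK.isCompact.isBounded hx hne
    rw [hK.frontier_eq] at hy
    obtain ⟨ψ, rfl⟩ := hy
    obtain ⟨φ, hφ, hψφ⟩ := (envelope_periodic hper).exists_mem_Ico₀ Real.two_pi_pos ψ
    rw [hψφ] at hne ⊢
    refine ⟨(r, φ), ⟨hr, lt_of_le_of_ne hφ.1 ?_, hφ.2⟩, rfl⟩
    rintro rfl
    exact hne (AffineMap.lineMap_same_apply _ _)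

theorem area_eq : area K = (1 / 2) * ∫ φ in (0 : ℝ)..(2 * π),
    supportFn K φ * (supportFn K φ + deriv (deriv (supportFn K)) φ) := by
  have hper := supportFn_periodic K
  have hcoords : coneMap (supportFn K) =
      fun z => !₂[coneMap (supportFn K) z 0, coneMap (supportFn K) z 1] := by
    ext z i
    fin_cases i <;> rfl
  have hvol : area K = ∫ _ in coneMap (supportFn K) '' coneDomain, (1 : ℝ) := by
    rw [hK.image_coneMap, setIntegral_const, smul_eq_mul, mul_one, Measure.real,
      measure_sdiff_null (measure_singleton _), area]
  have hinj := hK.coneMap_injOn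
  rw [hcoords] at hvol hinj
  rw [hvol, setIntegral_image_plane measurableSet_coneDomain
    (fun z _ => hasFDerivAt_coneMap hK.contDiff 0 z)
    (fun z _ => hasFDerivAt_coneMap hK.contDiff 1 z) hinj,
    setIntegral_congr_fun measurableSet_coneDomain fun z hz => by
      rw [hK.positivelyCurved.abs_jacobian_coneMap hper hz, mul_one],
    coneDomain, Measure.volume_eq_prod, setIntegral_prod_mul (fun r : ℝ => r)
      fun φ => (supportFn K φ + deriv (deriv (supportFn K)) φ) *
        gap (supportFn K) (envelope (supportFn K) 0) φ,
    ← intervalIntegral.integral_of_le zero_le_one, integral_id, ← integral_Ioc_eq_integral_Ioo,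
    ← intervalIntegral.integral_of_le Real.two_pi_pos.le,
    integral_mul_gap_eq hK.contDiff hper]
  norm_num

theorem norm_deriv_envelope (φ : ℝ) : ‖deriv (envelope (supportFn K)) φ‖ =
    supportFn K φ + deriv (deriv (supportFn K)) φ := by
  rw [(hasDerivAt_envelope hK.contDiff φ).deriv, norm_smul, norm_tangentVec, mul_one,
    Real.norm_eq_abs, abs_of_pos (hK.curvature_pos φ)]

theorem boundaryLength_eq : boundaryLength K = ∫ φ in (0 : ℝ)..(2 * π), supportFn K φ := by
  have hcont := continuous_deriv_deriv_of_contDiff_two hK.contDiff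
  have hclosed : ∫ φ in (0 : ℝ)..(2 * π), deriv (deriv (supportFn K)) φ = 0 := by
    rw [intervalIntegral.integral_eq_sub_of_hasDerivAt
      (fun φ _ => hasDerivAt_deriv_of_contDiff_two hK.contDiff φ) (hcont.intervalIntegrable _ _),
      (deriv_periodic (supportFn_periodic K)).eq, sub_self]
  simp only [boundaryLength, hK.norm_deriv_envelope]
  rw [intervalIntegral.integral_add (hK.contDiff.continuous.intervalIntegrable _ _)
    (hcont.intervalIntegrable _ _), hclosed, add_zero]

end IsStrictlyConvexC2

/-! ### Fourier coefficients -/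

theorem cosCoeff_neg (f : ℝ → ℝ) (n : ℤ) : cosCoeff f (-n) = cosCoeff f n := by
  simp [cosCoeff]

theorem sinCoeff_neg (f : ℝ → ℝ) (n : ℤ) : sinCoeff f (-n) = -sinCoeff f n := by
  simp [sinCoeff]

/-- The squared size of the `n`-th Fourier mode of `f`, without normalizing factor. -/
noncomputable def modePower (f : ℝ → ℝ) (n : ℤ) : ℝ :=
  cosCoeff f n ^ 2 + sinCoeff f n ^ 2

theorem modePower_nonneg (f : ℝ → ℝ) (n : ℤ) : 0 ≤ modePower f n := by
  unfold modePower
  positivity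

theorem modePower_neg (f : ℝ → ℝ) (n : ℤ) : modePower f (-n) = modePower f n := by
  rw [modePower, cosCoeff_neg, sinCoeff_neg, neg_sq, modePower]

theorem modePower_eq_zero_iff {f : ℝ → ℝ} {n : ℤ} :
    modePower f n = 0 ↔ cosCoeff f n = 0 ∧ sinCoeff f n = 0 := by
  rw [modePower, add_eq_zero_iff_of_nonneg (sq_nonneg _) (sq_nonneg _), sq_eq_zero_iff,
    sq_eq_zero_iff]

theorem modePower_const_mul (c : ℝ) (f : ℝ → ℝ) (n : ℤ) :
    modePower (fun x => c * f x) n = c ^ 2 * modePower f n := by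
  simp only [modePower, cosCoeff, sinCoeff, mul_assoc, intervalIntegral.integral_const_mul]
  ring

theorem modePower_add_eq_zero {f g : ℝ → ℝ} (hf : Continuous f) (hg : Continuous g) {n : ℤ}
    (hfn : modePower f n = 0) (hgn : modePower g n = 0) : modePower (fun x => f x + g x) n = 0 := by
  rw [modePower_eq_zero_iff] at *
  simp only [cosCoeff, sinCoeff, add_mul] at *
  constructor
  · rw [intervalIntegral.integral_add (Continuous.intervalIntegrable (by fun_prop) _ _)
      (Continuous.intervalIntegrable (by fun_prop) _ _), hfn.1, hgn.1, add_zero]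
  · rw [intervalIntegral.integral_add (Continuous.intervalIntegrable (by fun_prop) _ _)
      (Continuous.intervalIntegrable (by fun_prop) _ _), hfn.2, hgn.2, add_zero]

theorem hasDerivAt_cos_mul (k x : ℝ) :
    HasDerivAt (fun t => Real.cos (k * t)) (-(k * Real.sin (k * x))) x :=
  ((hasDerivAt_id' x).const_mul k).cos.congr_deriv (by ring)

theorem hasDerivAt_sin_mul (k x : ℝ) :
    HasDerivAt (fun t => Real.sin (k * t)) (k * Real.cos (k * x)) x :=
  ((hasDerivAt_id' x).const_mul k).sin.congr_deriv (by ring)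

section Derivative

variable {f : ℝ → ℝ} (hf : ContDiff ℝ 1 f) (hper : Function.Periodic f (2 * π))
include hf hper

theorem cosCoeff_deriv (n : ℤ) : cosCoeff (deriv f) n = n * sinCoeff f n := by
  have hparts := integral_mul_deriv_of_periodic hf (g := fun x => Real.cos (n * x))
    (by fun_prop) hper (periodic_cos_int_mul n)
  simp only [(hasDerivAt_cos_mul _ _).deriv, mul_neg, intervalIntegral.integral_neg,
    mul_left_comm _ (n : ℝ), intervalIntegral.integral_const_mul] at hparts
  exact (neg_injective hparts).symm

theorem sinCoeff_deriv (n : ℤ) : sinCoeff (deriv f) n = -(n * cosCoeff f n) := by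
  have hparts := integral_mul_deriv_of_periodic hf (g := fun x => Real.sin (n * x))
    (by fun_prop) hper (periodic_sin_int_mul n)
  simp only [(hasDerivAt_sin_mul _ _).deriv, mul_left_comm _ (n : ℝ),
    intervalIntegral.integral_const_mul] at hparts
  exact (neg_eq_iff_eq_neg.2 hparts).symm

theorem modePower_deriv (n : ℤ) : modePower (deriv f) n = n ^ 2 * modePower f n := by
  rw [modePower, cosCoeff_deriv hf hper, sinCoeff_deriv hf hper, modePower]
  ring

end Derivative

theorem modePower_deriv_deriv {f : ℝ → ℝ} (hf : ContDiff ℝ 2 f)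
    (hper : Function.Periodic f (2 * π)) (n : ℤ) :
    modePower (deriv (deriv f)) n = n ^ 4 * modePower f n := by
  rw [modePower_deriv (contDiff_deriv_of_contDiff_two hf) (deriv_periodic hper),
    modePower_deriv (hf.of_le one_le_two) hper]
  ring

theorem modePower_harmonic_eq_zero (a b : ℝ) {k n : ℤ} (hkn : |k| ≠ |n|) :
    modePower (fun x => a * Real.cos (k * x) + b * Real.sin (k * x)) n = 0 := by
  set f : ℝ → ℝ := fun x => a * Real.cos (k * x) + b * Real.sin (k * x) with hf
  have hper : Function.Periodic f (2 * π) := fun x => by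
    have hcos := periodic_cos_int_mul k x
    have hsin := periodic_sin_int_mul k x
    simp only at hcos hsin
    simp only [hf, hcos, hsin]
  have hderiv : deriv f = fun x => b * (k * Real.cos (k * x)) + a * -(k * Real.sin (k * x)) :=
    funext fun x => ((((hasDerivAt_cos_mul k x).const_mul a).fun_add
      ((hasDerivAt_sin_mul k x).const_mul b)).congr_deriv (add_comm _ _)).deriv
  have hharmonic : deriv (deriv f) = fun x => -k ^ 2 * f x := by
    rw [hderiv]
    refine funext fun x => (((((hasDerivAt_cos_mul k x).const_mul (k : ℝ)).const_mul b).fun_add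
      (((hasDerivAt_sin_mul k x).const_mul (k : ℝ)).neg.const_mul a)).congr_deriv ?_).deriv
    simp only [hf]
    ring
  have hpow := modePower_deriv_deriv (f := f) (by fun_prop) hper n
  rw [hharmonic, modePower_const_mul] at hpow
  have hne : (k : ℝ) ^ 4 ≠ n ^ 4 := fun h =>
    hkn <|
    abs_eq_abs.2 <| ((pow_eq_pow_iff_of_ne_zero four_ne_zero).1 (mod_cast h)).imp_right And.left
  exact (mul_eq_zero.1 (by linear_combination hpow :
    ((k : ℝ) ^ 4 - n ^ 4) * modePower f n = 0)).resolve_left (sub_ne_zero.2 hne)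

theorem fourier_apply_eq {T : ℝ} (hT : T = 2 * π) (n : ℤ) (x : ℝ) :
    fourier n (x : AddCircle T) = (Real.cos (n * x) : ℂ) + Real.sin (n * x) * Complex.I := by
  subst hT
  have hexponent : 2 * (π : ℂ) * Complex.I * n * x / ((2 * π : ℝ) : ℂ) =
      ((n * x : ℝ) : ℂ) * Complex.I := by
    have : (π : ℂ) ≠ 0 := Complex.ofReal_ne_zero.2 Real.pi_ne_zero
    push_cast
    field_simp
  rw [fourier_coe_apply, hexponent, Complex.exp_mul_I, Complex.ofReal_cos, Complex.ofReal_sin]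

theorem integral_fourier_smul_eq {T : ℝ} (hT : T = 2 * π) {f : ℝ → ℝ} (hf : Continuous f) (n : ℤ) :
    ∫ x in (0 : ℝ)..(2 * π), fourier (-n) (x : AddCircle T) • (f x : ℂ) =
      (cosCoeff f n : ℂ) - sinCoeff f n * Complex.I := by
  have hintegrand (x : ℝ) : fourier (-n) (x : AddCircle T) • (f x : ℂ) =
      ((f x * Real.cos (n * x) : ℝ) : ℂ) - ((f x * Real.sin (n * x) : ℝ) : ℂ) * Complex.I := by
    rw [fourier_apply_eq hT]
    push_cast
    rw [neg_mul, Complex.cos_neg, Complex.sin_neg, smul_eq_mul]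
    ring
  simp only [hintegrand]
  rw [intervalIntegral.integral_sub (Continuous.intervalIntegrable (by fun_prop) _ _)
    (Continuous.intervalIntegrable (by fun_prop) _ _), intervalIntegral.integral_mul_const,
    intervalIntegral.integral_ofReal, intervalIntegral.integral_ofReal]
  rfl

theorem sq_norm_fourierCoeffOn {f : ℝ → ℝ} (hf : Continuous f) (n : ℤ) :
    ‖fourierCoeffOn Real.two_pi_pos (fun x => (f x : ℂ)) n‖ ^ 2 =
      modePower f n / (2 * π) ^ 2 := by
  rw [fourierCoeffOn_eq_integral, integral_fourier_smul_eq (sub_zero _) hf, norm_smul,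
    mul_pow ‖_‖ ‖_‖, sub_zero, ← Complex.normSq_eq_norm_sq, Complex.normSq_apply,
    Real.norm_of_nonneg (by positivity)]
  simp only [Complex.sub_re, Complex.sub_im, Complex.mul_re, Complex.mul_im, Complex.ofReal_re,
    Complex.ofReal_im, Complex.I_re, Complex.I_im, modePower]
  ring

theorem hasSum_modePower {f : ℝ → ℝ} (hf : Continuous f) :
    HasSum (modePower f) (2 * π * ∫ x in (0 : ℝ)..(2 * π), f x ^ 2) := by
  have hcont : Continuous fun x => (f x : ℂ) := by fun_prop
  have hL2 : MemLp (fun x => (f x : ℂ)) 2 (volume.restrict (Ioc 0 (2 * π))) :=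
    ((memLp_two_iff_integrable_sq_norm hcont.aestronglyMeasurable).2
      (Continuous.integrableOn_Ioc (by fun_prop)))
  have hsum := (hasSum_sq_fourierCoeffOn Real.two_pi_pos hL2).mul_left ((2 * π) ^ 2)
  have hpi : (2 * π) ≠ 0 := Real.two_pi_pos.ne'
  simp only [sq_norm_fourierCoeffOn hf, mul_div_cancel₀ _ (pow_ne_zero 2 hpi), Complex.norm_real,
    Real.norm_eq_abs, sq_abs, sub_zero, smul_eq_mul] at hsum
  rwa [sq (2 * π), mul_assoc, mul_inv_cancel_left₀ hpi] at hsum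

theorem eq_sum_of_modePower_eq_zero {f : ℝ → ℝ} (hf : Continuous f)
    (hper : Function.Periodic f (2 * π)) {s : Finset ℤ} (h : ∀ n ∉ s, modePower f n = 0) (x : ℝ) :
    f x = ∑ n ∈ s, (cosCoeff f n * Real.cos (n * x) + sinCoeff f n * Real.sin (n * x)) /
      (2 * π) := by
  have : Fact (0 < 2 * π) := ⟨Real.two_pi_pos⟩
  have hperC : Function.Periodic (fun x => (f x : ℂ)) (2 * π) := fun x => by simp only [hper x]
  let F : C(AddCircle (2 * π), ℂ) :=
    ⟨hperC.lift, continuous_coinduced_dom.2 (Complex.continuous_ofReal.comp hf)⟩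
  have hcoeff (n : ℤ) : fourierCoeff F n =
      (1 / (2 * π) : ℝ) • ((cosCoeff f n : ℂ) - sinCoeff f n * Complex.I) := by
    rw [fourierCoeff_eq_intervalIntegral _ n 0, zero_add, ← integral_fourier_smul_eq rfl hf]
    rfl
  have hzero (n : ℤ) (hn : n ∉ s) : fourierCoeff F n = 0 := by
    obtain ⟨hcos, hsin⟩ := modePower_eq_zero_iff.1 (h n hn)
    rw [hcoeff, hcos, hsin]
    simp
  have hseries : F x = ∑ n ∈ s, fourierCoeff F n • fourier n (x : AddCircle (2 * π)) :=
    (has_pointwise_sum_fourier_series_of_summable (summable_of_ne_finset_zero hzero) _).unique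
      (hasSum_sum_of_ne_finset_zero (L := .unconditional ℤ)
        fun n hn => by rw [hzero n hn, zero_smul])
  calc f x = (F x).re := rfl
    _ = _ := by
      rw [hseries, Complex.re_sum]
      refine Finset.sum_congr rfl fun n _ => ?_
      rw [hcoeff, fourier_apply_eq rfl]
      generalize Real.cos (n * x) = c
      generalize Real.sin (n * x) = s
      simp only [Complex.real_smul, smul_eq_mul, Complex.mul_re, Complex.mul_im, Complex.add_re,
        Complex.add_im, Complex.sub_re, Complex.sub_im, Complex.ofReal_re, Complex.ofReal_im,
        Complex.I_re, Complex.I_im]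
      ring

/-! ### Parseval and the equality case -/

/-- The weights by which the mode powers of the support function enter the difference of the two
sides of the equality. They agree with the factor `n⁴ - 10n² + 9 = (n² - 1)(n² - 9)` coming from the
areas, except at `n = 0` and `n = ±2`, where `L²` and the visual angle integral cancel it. -/
noncomputable def deficitWeight (n : ℤ) : ℝ :=
  if 4 ≤ |n| then ((n : ℝ) ^ 2 - 1) * (n ^ 2 - 9) else 0

theorem deficitWeight_pos {n : ℤ} (hn : 4 ≤ |n|) : 0 < deficitWeight n := by
  have hsq : (4 : ℝ) ^ 2 ≤ n ^ 2 := sq_le_sq.2 (by rw [abs_of_pos four_pos]; exact_mod_cast hn)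
  rw [deficitWeight, if_pos hn]
  exact mul_pos (by linarith) (by linarith)

theorem deficitWeight_mul_modePower_nonneg (f : ℝ → ℝ) (n : ℤ) :
    0 ≤ deficitWeight n * modePower f n := by
  refine mul_nonneg ?_ (modePower_nonneg f n)
  by_cases hn : 4 ≤ |n|
  · exact (deficitWeight_pos hn).le
  · rw [deficitWeight, if_neg hn]

theorem deficitWeight_eq (n : ℤ) : deficitWeight n =
    n ^ 4 - 10 * n ^ 2 + 9 - (if n = 0 then 9 else 0) + (if n = 2 then 15 else 0) +
      if n = -2 then 15 else 0 := by
  by_cases hn : 4 ≤ |n|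
  · have h0 : n ≠ 0 := by rintro rfl; norm_num at hn
    have h2 : n ≠ 2 := by rintro rfl; norm_num at hn
    have hneg2 : n ≠ -2 := by rintro rfl; norm_num at hn
    rw [deficitWeight, if_pos hn, if_neg h0, if_neg h2, if_neg hneg2]
    ring
  · obtain ⟨hlower, hupper⟩ := abs_lt.1 (not_le.1 hn)
    rw [deficitWeight, if_neg hn]
    interval_cases n <;> norm_num

section Parseval

variable {f : ℝ → ℝ} (hf : ContDiff ℝ 2 f) (hper : Function.Periodic f (2 * π))
include hf hper

theorem hasSum_sq_mul_modePower : HasSum (fun n : ℤ => (n : ℝ) ^ 2 * modePower f n)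
    (2 * π * ∫ x in (0 : ℝ)..(2 * π), deriv f x ^ 2) := by
  have hsum := hasSum_modePower (contDiff_deriv_of_contDiff_two hf).continuous
  rwa [funext (modePower_deriv (hf.of_le one_le_two) hper)] at hsum

theorem hasSum_pow_four_mul_modePower : HasSum (fun n : ℤ => (n : ℝ) ^ 4 * modePower f n)
    (2 * π * ∫ x in (0 : ℝ)..(2 * π), deriv (deriv f) x ^ 2) := by
  have hsum := hasSum_modePower (continuous_deriv_deriv_of_contDiff_two hf)
  rwa [funext (modePower_deriv_deriv hf hper)] at hsum

theorem integral_sq_deriv_le_integral_sq_deriv_deriv :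
    ∫ x in (0 : ℝ)..(2 * π), deriv f x ^ 2 ≤ ∫ x in (0 : ℝ)..(2 * π), deriv (deriv f) x ^ 2 := by
  refine le_of_mul_le_mul_left (hasSum_le (fun n => ?_) (hasSum_sq_mul_modePower hf hper)
    (hasSum_pow_four_mul_modePower hf hper)) Real.two_pi_pos
  refine mul_le_mul_of_nonneg_right ?_ (modePower_nonneg f n)
  exact_mod_cast show n ^ 2 ≤ n ^ 4 by
    rw [← sq_abs, ← (by decide : Even 4).pow_abs n]
    rcases eq_or_ne n 0 with rfl | hn
    · norm_num
    · exact pow_le_pow_right₀ (Int.one_le_abs hn) (by norm_num)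

theorem integral_mul_add_deriv_deriv_eq :
    ∫ x in (0 : ℝ)..(2 * π), f x * (f x + deriv (deriv f) x) =
      (∫ x in (0 : ℝ)..(2 * π), f x ^ 2) - ∫ x in (0 : ℝ)..(2 * π), deriv f x ^ 2 := by
  have hcont := hf.continuous
  have hcont' := (contDiff_deriv_of_contDiff_two hf).continuous
  rw [← intervalIntegral.integral_sub (Continuous.intervalIntegrable (by fun_prop) _ _)
    (Continuous.intervalIntegrable (by fun_prop) _ _)]
  exact (mul_left_cancel₀ (by norm_num) (sweptArea_eq f hf hper)).symm

theorem hasSum_deficitWeight_mul_modePower :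
    HasSum (fun n => deficitWeight n * modePower f n)
      (2 * π * (∫ x in (0 : ℝ)..(2 * π), deriv (deriv f) x ^ 2) -
        10 * (2 * π * ∫ x in (0 : ℝ)..(2 * π), deriv f x ^ 2) +
        9 * (2 * π * ∫ x in (0 : ℝ)..(2 * π), f x ^ 2) -
        9 * modePower f 0 + 15 * modePower f 2 + 15 * modePower f (-2)) := by
  refine ((((((hasSum_pow_four_mul_modePower hf hper).sub
    ((hasSum_sq_mul_modePower hf hper).mul_left 10)).add
    ((hasSum_modePower hf.continuous).mul_left 9)).sub
    (hasSum_ite_eq 0 (9 * modePower f 0))).add (hasSum_ite_eq 2 (15 * modePower f 2))).add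
    (hasSum_ite_eq (-2) (15 * modePower f (-2)))).congr_fun fun n => ?_
  rw [deficitWeight_eq]
  split_ifs <;> first | lia | (subst_vars; ring)

end Parseval

/-- `f` is, up to the support function of a point, a trigonometric polynomial with frequencies
`0`, `2`, `3`: condition (3) freed from the choice of origin. -/
def HasModes (f : ℝ → ℝ) : Prop :=
  ∃ (c : Plane) (a₀ a₂ b₂ a₃ b₃ : ℝ), ∀ φ : ℝ, f φ = inner ℝ c (normalVec φ) + a₀
    + a₂ * Real.cos (2 * φ) + b₂ * Real.sin (2 * φ) + a₃ * Real.cos (3 * φ) + b₃ * Real.sin (3 * φ)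

theorem HasModes.modePower_eq_zero {f : ℝ → ℝ} (h : HasModes f) {n : ℤ} (hn : 4 ≤ |n|) :
    modePower f n = 0 := by
  obtain ⟨c, a₀, a₂, b₂, a₃, b₃, h⟩ := h
  let harmonic (a b : ℝ) (k : ℤ) (x : ℝ) : ℝ := a * Real.cos (k * x) + b * Real.sin (k * x)
  have hdecomp : f = fun x => harmonic a₀ 0 0 x + (harmonic (c 0) (c 1) 1 x +
      (harmonic a₂ b₂ 2 x + harmonic a₃ b₃ 3 x)) := by
    funext x
    rw [h, inner_normalVec]
    simp only [harmonic, Int.cast_zero, zero_mul, Real.cos_zero, Real.sin_zero, Int.cast_one,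
      one_mul, Int.cast_ofNat]
    ring
  have hzero (a b : ℝ) {k : ℤ} (hk : |k| < 4) : modePower (harmonic a b k) n = 0 :=
    modePower_harmonic_eq_zero a b (hk.trans_le hn).ne
  rw [hdecomp]
  exact modePower_add_eq_zero (by fun_prop) (by fun_prop) (hzero _ _ (by norm_num)) <|
    modePower_add_eq_zero (by fun_prop) (by fun_prop) (hzero _ _ (by norm_num)) <|
    modePower_add_eq_zero (by fun_prop) (by fun_prop) (hzero _ _ (by norm_num))
      (hzero _ _ (by norm_num))

theorem supportFn_image_sub {K : Set Plane} (hK : IsCompact K) (hne : K.Nonempty) (s : Plane)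
    (φ : ℝ) : supportFn ((fun x => x - s) '' K) φ = supportFn K φ - inner ℝ s (normalVec φ) := by
  have himage : (fun x => x - s) '' K = K + {-s} := by
    simp only [add_singleton, sub_eq_add_neg]
  rw [himage, supportFn_add K {-s} hK isCompact_singleton hne (singleton_nonempty _)]
  simp only [supportFn, image_singleton, csSup_singleton, inner_neg_left, sub_eq_add_neg]

namespace IsStrictlyConvexC2

variable {K : Set Plane} (hK : IsStrictlyConvexC2 K)
include hK

theorem inner_steinerPoint (φ : ℝ) : inner ℝ (steinerPoint K) (normalVec φ) =
    (cosCoeff (supportFn K) 1 * Real.cos φ + sinCoeff (supportFn K) 1 * Real.sin φ) / π := by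
  have := hK.contDiff.continuous
  have : Continuous normalVec := by
    unfold normalVec
    fun_prop
  have hcoord (i : Fin 2) : (∫ φ in (0 : ℝ)..(2 * π), supportFn K φ • normalVec φ) i =
      ∫ φ in (0 : ℝ)..(2 * π), supportFn K φ * normalVec φ i :=
    ((EuclideanSpace.proj i : Plane →L[ℝ] ℝ).intervalIntegral_comp_comm
      (Continuous.intervalIntegrable (by fun_prop) _ _)).symm
  rw [inner_normalVec, steinerPoint]
  simp only [PiLp.smul_apply, hcoord, smul_eq_mul]
  simp only [normalVec, cosCoeff, sinCoeff, Int.cast_one, one_mul, PiLp.toLp_apply,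
    Matrix.cons_val_zero, Matrix.cons_val_one]
  ring

theorem steinerSupportFn_eq (φ : ℝ) :
    steinerSupportFn K φ = supportFn K φ - inner ℝ (steinerPoint K) (normalVec φ) :=
  supportFn_image_sub hK.isCompact hK.nonempty _ _

theorem hasOnlyModesZeroTwoThree_of_modePower
    (h : ∀ n : ℤ, 4 ≤ |n| → modePower (supportFn K) n = 0) : HasOnlyModesZeroTwoThree K := by
  refine ⟨cosCoeff (supportFn K) 0 / (2 * π), cosCoeff (supportFn K) 2 / π,
    sinCoeff (supportFn K) 2 / π, cosCoeff (supportFn K) 3 / π, sinCoeff (supportFn K) 3 / π,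
    fun φ => ?_⟩
  have hsupport : ∀ n ∉ Finset.Icc (-3 : ℤ) 3, modePower (supportFn K) n = 0 := fun n hn =>
    h n (by rw [Finset.mem_Icc, ← abs_le] at hn; lia)
  have hIcc : Finset.Icc (-3 : ℤ) 3 = {-3, -2, -1, 0, 1, 2, 3} := by decide
  have hsum (g : ℤ → ℝ) : ∑ n ∈ Finset.Icc (-3) 3, g n =
      g (-3) + (g (-2) + (g (-1) + (g 0 + (g 1 + (g 2 + g 3))))) := by
    simp [hIcc]
  rw [hK.steinerSupportFn_eq, hK.inner_steinerPoint,
    eq_sum_of_modePower_eq_zero hK.contDiff.continuous (supportFn_periodic K) hsupport φ, hsum]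
  simp only [Int.cast_neg, Int.cast_zero, Int.cast_one, Int.cast_ofNat, cosCoeff_neg,
    sinCoeff_neg, neg_mul, zero_mul, one_mul, Real.cos_neg, Real.sin_neg, Real.cos_zero,
    Real.sin_zero]
  ring

theorem hasOnlyModesZeroTwoThree_iff : HasOnlyModesZeroTwoThree K ↔ HasModes (supportFn K) := by
  refine ⟨fun ⟨a₀, a₂, b₂, a₃, b₃, h⟩ => ⟨steinerPoint K, a₀, a₂, b₂, a₃, b₃, fun φ => ?_⟩,
    fun h => hK.hasOnlyModesZeroTwoThree_of_modePower fun n => h.modePower_eq_zero⟩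
  linarith [h φ, hK.steinerSupportFn_eq φ]

theorem abs_evoluteArea : |evoluteArea K| =
    ((∫ φ in (0 : ℝ)..(2 * π), deriv (deriv (supportFn K)) φ ^ 2) -
      ∫ φ in (0 : ℝ)..(2 * π), deriv (supportFn K) φ ^ 2) / 2 := by
  have := hK.continuous_deriv
  have := continuous_deriv_deriv_of_contDiff_two hK.contDiff
  have hper := deriv_periodic (supportFn_periodic K)
  have hshift := integral_comp_add_of_periodic
    (f := fun φ => deriv (supportFn K) φ ^ 2 - deriv (deriv (supportFn K)) φ ^ 2)
    (fun φ => by simp only [hper φ, deriv_periodic hper φ]) (-(π / 2))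
  have hderiv (φ : ℝ) :
      deriv (evoluteSupport K) φ = deriv (deriv (supportFn K)) (φ - π / 2) :=
    deriv_comp_sub_const _ _ _
  have hle := integral_sq_deriv_le_integral_sq_deriv_deriv hK.contDiff (supportFn_periodic K)
  simp only [evoluteArea, sweptArea, hderiv]
  simp only [evoluteSupport, sub_eq_add_neg] at hshift ⊢
  simp only [← sub_eq_add_neg] at hshift ⊢
  rw [hshift, intervalIntegral.integral_sub (Continuous.intervalIntegrable (by fun_prop) _ _)
    (Continuous.intervalIntegrable (by fun_prop) _ _), abs_of_nonpos (by linarith)]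
  ring

theorem sq_boundaryLength : boundaryLength K ^ 2 = modePower (supportFn K) 0 := by
  rw [hK.boundaryLength_eq]
  simp [modePower, cosCoeff, sinCoeff]

theorem hasSum_equalityDeficit :
    HasSum (fun n => deficitWeight n * modePower (supportFn K) n)
      (4 * (π * |evoluteArea K| - (boundaryLength K ^ 2 - 4 * π * area K) -
        ((5 / 4) * boundaryLength K ^ 2 + 5 * ∫ P in Kᶜ, visualIntegrand K P))) := by
  convert hasSum_deficitWeight_mul_modePower hK.contDiff (supportFn_periodic K) using 1
  rw [hK.abs_evoluteArea, hK.sq_boundaryLength, hK.area_eq, hK.integral_visualIntegrand,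
    integral_mul_add_deriv_deriv_eq hK.contDiff (supportFn_periodic K), modePower_neg,
    modePower.eq_1 _ 2]
  ring

theorem equalityHolds_iff_modePower :
    EqualityHolds K ↔ ∀ n : ℤ, 4 ≤ |n| → modePower (supportFn K) n = 0 := by
  have hsum := hK.hasSum_equalityDeficit
  have hterms : (fun n => deficitWeight n * modePower (supportFn K) n) = 0 ↔
      ∀ n : ℤ, 4 ≤ |n| → modePower (supportFn K) n = 0 := by
    refine funext_iff.trans (forall_congr' fun n => ?_)
    by_cases hn : 4 ≤ |n|
    · simp only [hn, forall_const, Pi.zero_apply, mul_eq_zero, (deficitWeight_pos hn).ne', false_or]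
    · simp only [deficitWeight, hn, if_false, zero_mul, Pi.zero_apply, false_imp_iff]
  rw [EqualityHolds, ← sub_eq_zero, ← hterms,
    ← hasSum_zero_iff_of_nonneg (L := .unconditional ℤ) (deficitWeight_mul_modePower_nonneg _)]
  refine ⟨fun h => ?_, fun h => ?_⟩
  · rwa [h, mul_zero] at hsum
  · linarith [hsum.unique h]

theorem equalityHolds_iff_hasModes : EqualityHolds K ↔ HasModes (supportFn K) := by
  rw [hK.equalityHolds_iff_modePower]
  exact ⟨fun h => hK.hasOnlyModesZeroTwoThree_iff.1 (hK.hasOnlyModesZeroTwoThree_of_modePower h),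
    fun h n => h.modePower_eq_zero⟩

end IsStrictlyConvexC2

/-! ### Hypocycloids, disks and trigonometric support functions -/

theorem inner_rotate_normalVec (α φ : ℝ) (v : Plane) :
    inner ℝ (rotate α v) (normalVec φ) = v 0 * Real.cos (φ - α) + v 1 * Real.sin (φ - α) := by
  rw [inner_normalVec, Real.cos_sub, Real.sin_sub]
  simp only [rotate, normalVec, tangentVec, PiLp.add_apply, PiLp.smul_apply, smul_eq_mul,
    Matrix.cons_val_zero, Matrix.cons_val_one, Matrix.cons_val_fin_one]
  ring

theorem inner_rotate_tangentVec (α φ : ℝ) (v : Plane) :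
    inner ℝ (rotate α v) (tangentVec φ) = v 1 * Real.cos (φ - α) - v 0 * Real.sin (φ - α) := by
  rw [inner_tangentVec, Real.cos_sub, Real.sin_sub]
  simp only [rotate, normalVec, tangentVec, PiLp.add_apply, PiLp.smul_apply, smul_eq_mul,
    Matrix.cons_val_zero, Matrix.cons_val_one, Matrix.cons_val_fin_one]
  ring

theorem inner_rotate_hypocycloid_normalVec (k r α t : ℝ) :
    inner ℝ (rotate α (hypocycloid k r t)) (normalVec (α + (k - 2) / 2 * t)) =
      r * (k - 2) * Real.sin (k / 2 * t) := by
  have hadd := Real.sin_add t ((k - 2) / 2 * t)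
  have hsub := Real.sin_sub ((k - 1) * t) ((k - 2) / 2 * t)
  rw [show t + (k - 2) / 2 * t = k / 2 * t by ring] at hadd
  rw [show (k - 1) * t - (k - 2) / 2 * t = k / 2 * t by ring] at hsub
  rw [inner_rotate_normalVec, add_sub_cancel_left]
  simp only [hypocycloid, Matrix.cons_val_zero, Matrix.cons_val_one, Matrix.cons_val_fin_one]
  linear_combination (-r * (k - 1)) * hadd + r * hsub

theorem inner_rotate_hypocycloid_tangentVec (k r α t : ℝ) :
    inner ℝ (rotate α (hypocycloid k r t)) (tangentVec (α + (k - 2) / 2 * t)) =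
      r * k * Real.cos (k / 2 * t) := by
  have hadd := Real.cos_add t ((k - 2) / 2 * t)
  have hsub := Real.cos_sub ((k - 1) * t) ((k - 2) / 2 * t)
  rw [show t + (k - 2) / 2 * t = k / 2 * t by ring] at hadd
  rw [show (k - 1) * t - (k - 2) / 2 * t = k / 2 * t by ring] at hsub
  rw [inner_rotate_tangentVec, add_sub_cancel_left]
  simp only [hypocycloid, Matrix.cons_val_zero, Matrix.cons_val_one, Matrix.cons_val_fin_one]
  linear_combination (-r * (k - 1)) * hadd - r * hsub

/-- The support function of the curve at signed distance `d` from the hypocycloid with centre `c`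
whose support function about `c` is the pure harmonic `A sin (k(φ - α))`: a parallel curve of an
astroid for `k = 2`, of a Steiner curve for `k = 3`. -/
noncomputable def harmonicSupport (c : Plane) (d A k α φ : ℝ) : ℝ :=
  inner ℝ c (normalVec φ) + d + A * Real.sin (k * (φ - α))

theorem normalVec_add_pi (φ : ℝ) : normalVec (φ + π) = -normalVec φ := by
  ext i
  fin_cases i <;> simp [normalVec]

section HarmonicSupport

variable (c : Plane) (d A k α : ℝ)

theorem contDiff_harmonicSupport (n : ℕ∞) : ContDiff ℝ n (harmonicSupport c d A k α) :=
  ((contDiff_inner_normalVec c n).add contDiff_const).add (by fun_prop)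

theorem deriv_harmonicSupport : deriv (harmonicSupport c d A k α) =
    fun φ => inner ℝ c (tangentVec φ) + A * k * Real.cos (k * (φ - α)) := by
  refine funext fun φ => HasDerivAt.deriv ?_
  have hsin := (((hasDerivAt_id' φ).sub_const α).const_mul k).sin.const_mul A
  exact (((hasDerivAt_inner_normalVec c φ).add_const d).add hsin).congr_deriv (by ring)

theorem harmonicSupport_add_deriv_deriv (φ : ℝ) :
    harmonicSupport c d A k α φ + deriv (deriv (harmonicSupport c d A k α)) φ =
      d + A * (1 - k ^ 2) * Real.sin (k * (φ - α)) := by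
  have hcos := (((hasDerivAt_id' φ).sub_const α).const_mul k).cos.const_mul (A * k)
  rw [deriv_harmonicSupport, ((hasDerivAt_inner_tangentVec c φ).fun_add hcos).deriv,
    harmonicSupport]
  ring

theorem harmonicSupport_periodic (k : ℕ) :
    Function.Periodic (harmonicSupport c d A k α) (2 * π) := fun φ => by
  rw [harmonicSupport, normalVec_periodic, show (k : ℝ) * (φ + 2 * π - α) =
    k * (φ - α) + k * (2 * π) by ring, Real.sin_add_nat_mul_two_pi, harmonicSupport]

theorem neg_harmonicSupport_add_pi (k : ℕ) (φ : ℝ) : -harmonicSupport c d A k α (φ + π) =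
    harmonicSupport c (-d) (-(-1) ^ k * A) k α φ := by
  rw [harmonicSupport, harmonicSupport, normalVec_add_pi, inner_neg_right,
    show (k : ℝ) * (φ + π - α) = k * (φ - α) + k * π by ring, Real.sin_add_nat_mul_pi]
  ring

end HarmonicSupport

theorem isHypocycloidSupport_iff {k : ℝ} (hk : k ≠ 2) (g : ℝ → ℝ) :
    IsHypocycloidSupport k g ↔ ∃ (r : ℝ) (c : Plane) (α : ℝ), 0 < r ∧
      g = harmonicSupport c 0 (r * (k - 2)) (k / (k - 2)) α := by
  have hk2 : k - 2 ≠ 0 := sub_ne_zero.2 hk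
  have hangle (α t : ℝ) : k / (k - 2) * (α + (k - 2) / 2 * t - α) = k / 2 * t := by
    field_simp
    ring
  refine exists_congr fun r => exists_congr fun c => exists_congr fun α => and_congr_right fun _ =>
    ⟨fun h => funext fun τ => ?_, ?_⟩
  · obtain ⟨t, rfl⟩ : ∃ t, τ = α + (k - 2) / 2 * t := ⟨2 / (k - 2) * (τ - α), by field_simp; ring⟩
    rw [← inner_envelope_normalVec_self g, h, inner_add_left, inner_rotate_hypocycloid_normalVec,
      harmonicSupport, hangle, add_zero]
  · rintro rfl t
    apply plane_ext_of_inner (α + (k - 2) / 2 * t)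
    · rw [inner_envelope_normalVec_self, inner_add_left, inner_rotate_hypocycloid_normalVec,
        harmonicSupport, hangle, add_zero]
    · rw [inner_envelope_tangentVec, sub_self, Real.cos_zero, Real.sin_zero, inner_add_left,
        inner_rotate_hypocycloid_tangentVec, deriv_harmonicSupport]
      beta_reduce
      rw [hangle, mul_one, mul_zero, sub_zero, mul_assoc r, mul_div_cancel₀ _ hk2]

theorem exists_eq_isHypocycloidSupport_add_iff {k : ℝ} (hk : 2 < k) (f : ℝ → ℝ) :
    (∃ (g : ℝ → ℝ) (d : ℝ), IsHypocycloidSupport k g ∧ ∀ t : ℝ, f t = g t + d) ↔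
      ∃ (c : Plane) (d A α : ℝ), 0 < A ∧ f = harmonicSupport c d A (k / (k - 2)) α := by
  have hk2 : 0 < k - 2 := sub_pos.2 hk
  simp only [isHypocycloidSupport_iff hk.ne']
  constructor
  · rintro ⟨_, d, ⟨r, c, α, hr, rfl⟩, hf⟩
    refine ⟨c, d, r * (k - 2), α, by positivity, funext fun t => ?_⟩
    rw [hf, harmonicSupport, harmonicSupport]
    ring
  · rintro ⟨c, d, A, α, hA, rfl⟩
    refine ⟨_, d, ⟨A / (k - 2), c, α, by positivity, rfl⟩, fun t => ?_⟩
    rw [harmonicSupport, harmonicSupport, div_mul_cancel₀ _ hk2.ne']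
    ring

theorem isAstroidParallel_iff (f : ℝ → ℝ) : IsAstroidParallel f ↔
    ∃ (c : Plane) (d A α : ℝ), 0 < A ∧ f = harmonicSupport c d A 2 α := by
  have h := exists_eq_isHypocycloidSupport_add_iff (k := 4) (by norm_num) f
  rwa [show (4 : ℝ) / (4 - 2) = 2 by norm_num] at h

theorem isDeltoidParallel_iff (f : ℝ → ℝ) : IsDeltoidParallel f ↔
    ∃ (c : Plane) (d A α : ℝ), 0 < A ∧ f = harmonicSupport c d A 3 α := by
  have h := exists_eq_isHypocycloidSupport_add_iff (k := 3) (by norm_num) f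
  rwa [show (3 : ℝ) / (3 - 2) = 3 by norm_num] at h

theorem supportFn_closedBall (c : Plane) {r : ℝ} (hr : 0 ≤ r) (φ : ℝ) :
    supportFn (Metric.closedBall c r) φ = inner ℝ c (normalVec φ) + r := by
  refine IsGreatest.csSup_eq ⟨⟨c + r • normalVec φ, ?_, ?_⟩, ?_⟩
  · rw [mem_closedBall_iff_norm, add_sub_cancel_left, norm_smul, norm_normalVec, mul_one,
      Real.norm_of_nonneg hr]
  · simp only [inner_add_left, real_inner_smul_left, real_inner_self_eq_norm_sq, norm_normalVec,
      one_pow, mul_one]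
  · rintro _ ⟨x, hx, rfl⟩
    have hle := real_inner_le_norm (x - c) (normalVec φ)
    rw [norm_normalVec, mul_one, inner_sub_left] at hle
    exact sub_le_iff_le_add'.1 (hle.trans (mem_closedBall_iff_norm.1 hx))

theorem HasModes.add {f g : ℝ → ℝ} (hf : HasModes f) (hg : HasModes g) :
    HasModes fun φ => f φ + g φ := by
  obtain ⟨c, a₀, a₂, b₂, a₃, b₃, hf⟩ := hf
  obtain ⟨c', a₀', a₂', b₂', a₃', b₃', hg⟩ := hg
  refine ⟨c + c', a₀ + a₀', a₂ + a₂', b₂ + b₂', a₃ + a₃', b₃ + b₃', fun φ => ?_⟩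
  simp only [hf, hg, inner_add_left]
  ring

theorem hasModes_inner_add (c : Plane) (d : ℝ) : HasModes fun φ => inner ℝ c (normalVec φ) + d :=
  ⟨c, d, 0, 0, 0, 0, fun φ => by ring⟩

theorem HasModes.sum {ι : Type*} (s : Finset ι) {f : ι → ℝ → ℝ} (hf : ∀ i, HasModes (f i)) :
    HasModes fun φ => ∑ i ∈ s, f i φ := by
  classical
  induction s using Finset.induction_on with
  | empty => simpa using hasModes_inner_add 0 0
  | insert i s hi ih => simpa only [Finset.sum_insert hi] using (hf i).add ih

theorem hasModes_harmonicSupport_two (c : Plane) (d A α : ℝ) :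
    HasModes (harmonicSupport c d A 2 α) := by
  refine ⟨c, d, -A * Real.sin (2 * α), A * Real.cos (2 * α), 0, 0, fun φ => ?_⟩
  rw [harmonicSupport, mul_sub, Real.sin_sub]
  ring

theorem hasModes_harmonicSupport_three (c : Plane) (d A α : ℝ) :
    HasModes (harmonicSupport c d A 3 α) := by
  refine ⟨c, d, 0, 0, -A * Real.sin (3 * α), A * Real.cos (3 * α), fun φ => ?_⟩
  rw [harmonicSupport, mul_sub, Real.sin_sub]
  ring

theorem IsAstroidParallel.hasModes {f : ℝ → ℝ} (hf : IsAstroidParallel f) : HasModes f := by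
  obtain ⟨c, d, A, α, -, rfl⟩ := (isAstroidParallel_iff f).1 hf
  exact hasModes_harmonicSupport_two c d A α

theorem IsDeltoidParallel.hasModes {f : ℝ → ℝ} (hf : IsDeltoidParallel f) : HasModes f := by
  obtain ⟨c, d, A, α, -, rfl⟩ := (isDeltoidParallel_iff f).1 hf
  exact hasModes_harmonicSupport_three c d A α

theorem IsDiskSupport.hasModes {f : ℝ → ℝ} (hf : IsDiskSupport f) : HasModes f := by
  obtain ⟨c, r, hr, hf⟩ := hf
  rw [funext hf, funext (supportFn_closedBall c hr.le)]
  exact hasModes_inner_add c r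

theorem IsMinkowskiSumType.hasModes {K : Set Plane} (hK : IsMinkowskiSumType K) :
    HasModes (supportFn K) := by
  obtain ⟨n, f, -, hf, hsum⟩ := hK
  rw [funext hsum]
  exact HasModes.sum _ fun i => (hf i).elim (·.hasModes) (·.elim (·.hasModes) (·.hasModes))

theorem exists_amplitude (a b : ℝ) {k : ℝ} (hk : k ≠ 0) :
    ∃ A α : ℝ, 0 ≤ A ∧ ∀ x, a * Real.cos (k * x) + b * Real.sin (k * x) =
      A * Real.sin (k * (x - α)) := by
  refine ⟨‖(⟨b, -a⟩ : ℂ)‖, Complex.arg ⟨b, -a⟩ / k, norm_nonneg _, fun x => ?_⟩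
  have hcos : ‖(⟨b, -a⟩ : ℂ)‖ * Real.cos (Complex.arg ⟨b, -a⟩) = b := Complex.norm_mul_cos_arg _
  have hsin : ‖(⟨b, -a⟩ : ℂ)‖ * Real.sin (Complex.arg ⟨b, -a⟩) = -a := Complex.norm_mul_sin_arg _
  rw [mul_sub, mul_div_cancel₀ _ hk, Real.sin_sub]
  linear_combination Real.cos (k * x) * hsin - Real.sin (k * x) * hcos

theorem HasModes.exists_eq_harmonicSupport_add {f : ℝ → ℝ} (hf : HasModes f) :
    ∃ (c : Plane) (d A α B β : ℝ), 0 ≤ A ∧ 0 ≤ B ∧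
      ∀ φ, f φ = harmonicSupport c d A 2 α φ + harmonicSupport 0 0 B 3 β φ := by
  obtain ⟨c, a₀, a₂, b₂, a₃, b₃, hf⟩ := hf
  obtain ⟨A, α, hA, hα⟩ := exists_amplitude a₂ b₂ two_ne_zero
  obtain ⟨B, β, hB, hβ⟩ := exists_amplitude a₃ b₃ three_ne_zero
  refine ⟨c, a₀, A, α, B, β, hA, hB, fun φ => ?_⟩
  rw [hf, harmonicSupport, harmonicSupport, ← hα, ← hβ, inner_zero_left]
  ring

/-! ### Domains bounded by a curve with a given generalized support function -/

theorem countable_setOf_sin_eq (s : ℝ) : {x | Real.sin x = s}.Countable := by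
  rcases eq_empty_or_nonempty {x | Real.sin x = s} with hempty | ⟨x₀, hx₀⟩
  · exact hempty ▸ countable_empty
  refine ((countable_range fun n : ℤ => 2 * n * π + x₀).union
    (countable_range fun n : ℤ => (2 * n + 1) * π - x₀)).mono fun x hx => ?_
  obtain ⟨n, h | h⟩ := Real.sin_eq_sin_iff.1 (hx₀.trans hx.symm)
  · exact Or.inl ⟨n, h.symm⟩
  · exact Or.inr ⟨n, h.symm⟩

theorem countable_setOf_add_mul_sin_eq_zero (a α : ℝ) {b k : ℝ} (hb : b ≠ 0) (hk : k ≠ 0) :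
    {t | a + b * Real.sin (k * (t - α)) = 0}.Countable := by
  have hinj : Function.Injective fun t => k * (t - α) :=
    (mul_right_injective₀ hk).comp (sub_left_injective (b := α))
  refine ((countable_setOf_sin_eq (-a / b)).preimage_of_injOn hinj.injOn).mono fun t ht => ?_
  exact (eq_div_iff hb).2 (by linarith [show a + b * Real.sin (k * (t - α)) = 0 from ht])

theorem PositivelyCurved.countable_envelope_preimage {p : ℝ → ℝ} (hp : PositivelyCurved p)
    (hper : Function.Periodic p (2 * π)) {Z : Set Plane} (hZ : Z.Countable) :
    (envelope p ⁻¹' Z).Countable := by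
  have hcover : envelope p ⁻¹' Z =
      ⋃ n : ℤ, envelope p ⁻¹' Z ∩ Ico (n • (2 * π)) ((n + 1) • (2 * π)) := by
    rw [← inter_iUnion, iUnion_Ico_zsmul Real.two_pi_pos, inter_univ]
  rw [hcover]
  refine countable_iUnion fun n => MapsTo.countable_of_injOn (f := envelope p)
    (fun x hx => hx.1) ?_ hZ
  rw [add_smul, one_smul]
  exact (hp.envelope_injOn hper _).mono inter_subset_right

section Contact

variable {f : ℝ → ℝ} {t ψ : ℝ}

theorem sin_sub_eq_zero_of_isLocalMax (hf : ContDiff ℝ 2 f)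
    (hmax : IsLocalMax (fun s => (inner ℝ (envelope f s) (normalVec ψ) : ℝ)) t)
    (hregular : f t + deriv (deriv f) t ≠ 0) : Real.sin (ψ - t) = 0 := by
  have hderiv := (hasDerivAt_envelope hf t).inner ℝ (hasDerivAt_const t (normalVec ψ))
  have hzero := hmax.hasDerivAt_eq_zero hderiv
  rw [inner_zero_right, zero_add, real_inner_smul_left, inner_tangentVec_normalVec] at hzero
  exact (mul_eq_zero.1 hzero).resolve_left hregular

theorem inner_envelope_normalVec_of_sin_eq_zero (hper : Function.Periodic f (2 * π))
    (hsin : Real.sin (ψ - t) = 0) : inner ℝ (envelope f t) (normalVec ψ) = f ψ ∨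
      inner ℝ (envelope f t) (normalVec ψ) = -f (ψ + π) := by
  obtain ⟨n, hn⟩ := Real.sin_eq_zero_iff.1 hsin
  rw [inner_envelope_normalVec, hsin, mul_zero, add_zero]
  rcases Int.even_or_odd' n with ⟨m, rfl | rfl⟩ <;> push_cast at hn
  · left
    rw [show ψ = t + m * (2 * π) by linarith, hper.int_mul m t,
      show t + m * (2 * π) - t = 0 + m * (2 * π) by ring, Real.cos_add_int_mul_two_pi,
      Real.cos_zero, mul_one]
  · right
    rw [show ψ + π = t + (m + 1 : ℤ) * (2 * π) by push_cast; linarith, hper.int_mul (m + 1) t,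
      show ψ - t = π + m * (2 * π) by linarith, Real.cos_add_int_mul_two_pi, Real.cos_pi, mul_neg,
      mul_one]

end Contact

/-- Away from countably many normal directions, the point of `K` with outer normal `N(ψ)` is a
regular point of the bounding curve, whose normal there must be `±N(ψ)`. -/
theorem IsStrictlyConvexC2.eq_or_eq_neg_of_isBoundedBy {K : Set Plane}
    (hK : IsStrictlyConvexC2 K) {f : ℝ → ℝ} (hf : ContDiff ℝ 2 f)
    (hper : Function.Periodic f (2 * π)) (hZ : {t | f t + deriv (deriv f) t = 0}.Countable)
    (hb : IsBoundedBy K f) (φ : ℝ) :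
    supportFn K φ = f φ ∨ supportFn K φ = -f (φ + π) := by
  have := hf.continuous
  have := hK.contDiff.continuous
  have hclosed : IsClosed {φ | supportFn K φ = f φ ∨ supportFn K φ = -f (φ + π)} :=
    (isClosed_eq (by fun_prop) (by fun_prop)).union (isClosed_eq (by fun_prop) (by fun_prop))
  have hdense := (hK.positivelyCurved.countable_envelope_preimage (supportFn_periodic K)
    (hZ.image (envelope f))).dense_compl ℝ
  refine hclosed.closure_subset_iff.2 (fun ψ hψ => ?_) (hdense φ)
  rw [IsBoundedBy] at hb
  obtain ⟨t, ht⟩ : envelope (supportFn K) ψ ∈ range (envelope f) := by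
    rw [← hb, hK.frontier_eq]
    exact mem_range_self ψ
  have hsupport : inner ℝ (envelope f t) (normalVec ψ) = supportFn K ψ := by
    rw [ht, inner_envelope_normalVec_self]
  have hmem (s : ℝ) : envelope f s ∈ K :=
    hK.isCompact.isClosed.frontier_subset (hb ▸ mem_range_self s)
  have hmax : IsLocalMax (fun s => (inner ℝ (envelope f s) (normalVec ψ) : ℝ)) t :=
    Filter.Eventually.of_forall fun s =>
      (inner_le_supportFn hK.isCompact (hmem s) ψ).trans_eq hsupport.symm
  have hsin := sin_sub_eq_zero_of_isLocalMax hf hmax fun h0 => hψ ⟨t, h0, ht⟩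
  rw [mem_ofPred_eq, ← hsupport]
  exact inner_envelope_normalVec_of_sin_eq_zero hper hsin

theorem IsStrictlyConvexC2.eq_or_eq_of_isBoundedBy_harmonicSupport {K : Set Plane}
    (hK : IsStrictlyConvexC2 K) {c : Plane} {d A α : ℝ} (hA : A ≠ 0) {k : ℕ} (hk : 1 < k)
    (hb : IsBoundedBy K (harmonicSupport c d A k α)) (φ : ℝ) :
    supportFn K φ = harmonicSupport c d A k α φ ∨
      supportFn K φ = harmonicSupport c (-d) (-(-1) ^ k * A) k α φ := by
  have hk1 : (1 : ℝ) < k := mod_cast hk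
  rw [← neg_harmonicSupport_add_pi]
  refine hK.eq_or_eq_neg_of_isBoundedBy (contDiff_harmonicSupport c d A k α 2)
    (harmonicSupport_periodic c d A α k) ?_ hb φ
  simp only [harmonicSupport_add_deriv_deriv]
  exact countable_setOf_add_mul_sin_eq_zero d α (mul_ne_zero hA (by nlinarith)) (by positivity)

theorem eq_or_eq_of_forall_eq_or_eq {X Y : Type*} [TopologicalSpace X] [PreconnectedSpace X]
    [TopologicalSpace Y] [T2Space Y] {p f g : X → Y} (hp : Continuous p) (hf : Continuous f)
    (hg : Continuous g) (h : ∀ x, p x = f x ∨ p x = g x) (hfg : ∀ x, f x ≠ g x) :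
    p = f ∨ p = g := by
  have hcompl : {x | p x = f x}ᶜ = {x | p x = g x} := by
    ext x
    exact ⟨(h x).resolve_left, fun hx hx' => hfg x (hx'.symm.trans hx)⟩
  have hclopen : IsClopen {x | p x = f x} :=
    ⟨isClosed_eq hp hf, isClosed_compl_iff.1 (hcompl ▸ isClosed_eq hp hg)⟩
  rcases isClopen_iff.1 hclopen with hempty | huniv
  · exact Or.inr (funext fun x => (h x).resolve_left (eq_empty_iff_forall_notMem.1 hempty x))
  · exact Or.inl (funext (eq_univ_iff_forall.1 huniv))

theorem curvature_eq_or_eq_of_forall_eq_or_eq {p f g : ℝ → ℝ} (hp : ContDiff ℝ 2 p)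
    (hf : ContDiff ℝ 2 f) (hg : ContDiff ℝ 2 g) (h : ∀ φ, p φ = f φ ∨ p φ = g φ) (φ : ℝ) :
    p φ + deriv (deriv p) φ = f φ + deriv (deriv f) φ ∨
      p φ + deriv (deriv p) φ = g φ + deriv (deriv g) φ := by
  have hcurv {u : ℝ → ℝ} (hu : ContDiff ℝ 2 u) : Continuous fun t => u t + deriv (deriv u) t :=
    hu.continuous.add (continuous_deriv_deriv_of_contDiff_two hu)
  have hlocal {u : ℝ → ℝ} {t : ℝ} (hu : p =ᶠ[nhds t] u) :
      p t + deriv (deriv p) t = u t + deriv (deriv u) t := by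
    rw [hu.eq_of_nhds, hu.deriv.deriv_eq]
  by_contra! hne
  refine hne.2 (hlocal ?_)
  filter_upwards [(isOpen_ne_fun (hcurv hp) (hcurv hf)).mem_nhds hne.1] with t ht
  by_contra hpg
  refine ht (hlocal ?_)
  filter_upwards [(isOpen_ne_fun hp.continuous hg.continuous).mem_nhds hpg] with s hs
  exact (h s).resolve_right hs

theorem eq_of_supportFn_eq {K L : Set Plane} (hK : IsCompact K) (hKc : Convex ℝ K)
    (hKne : K.Nonempty) (hL : IsCompact L) (hLc : Convex ℝ L) (hLne : L.Nonempty)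
    (h : supportFn K = supportFn L) : K = L :=
  Subset.antisymm
    (fun _ hx => mem_of_forall_inner_le hL hLc hLne (h ▸ inner_le_supportFn hK hx))
    (fun _ hx => mem_of_forall_inner_le hK hKc hKne (h ▸ inner_le_supportFn hL hx))

namespace IsStrictlyConvexC2

variable {K : Set Plane} (hK : IsStrictlyConvexC2 K)
include hK

/-- A value `s` of `sin (2(φ - α))` at which the two candidates `±d + …` for the support function
coincide satisfies `d + A s = 0`; the radius of curvature `±(d - 3A sin (2(t - α)))` of `K` would
then vanish where `sin (2(t - α)) = -s / 3`. -/
theorem hasModes_of_isAstroidParallel {f : ℝ → ℝ} (hf : IsAstroidParallel f)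
    (hb : IsBoundedBy K f) : HasModes (supportFn K) := by
  obtain ⟨c, d, A, α, hA, rfl⟩ := (isAstroidParallel_iff f).1 hf
  have hcontDiff (d A : ℝ) := contDiff_harmonicSupport c d A 2 α 2
  have heq (φ : ℝ) : supportFn K φ = harmonicSupport c d A 2 α φ ∨
      supportFn K φ = harmonicSupport c (-d) (-A) 2 α φ := by
    simpa using hK.eq_or_eq_of_isBoundedBy_harmonicSupport hA.ne' one_lt_two
      (by simpa using hb) φ
  have hne (φ : ℝ) : harmonicSupport c d A 2 α φ ≠ harmonicSupport c (-d) (-A) 2 α φ := by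
    intro hφ
    set s := Real.sin (2 * (φ - α)) with hs
    have hs1 : |s| ≤ 1 := Real.abs_sin_le_one _
    have hds : d + A * s = 0 := by
      rw [harmonicSupport, harmonicSupport, ← hs] at hφ
      linarith
    have hsin : Real.sin (2 * (α + Real.arcsin (-s / 3) / 2 - α)) = -s / 3 := by
      rw [add_sub_cancel_left, mul_div_cancel₀ _ two_ne_zero,
        Real.sin_arcsin (by linarith [abs_le.1 hs1]) (by linarith [abs_le.1 hs1])]
    have hpos := hK.curvature_pos (α + Real.arcsin (-s / 3) / 2)
    rcases curvature_eq_or_eq_of_forall_eq_or_eq hK.contDiff (hcontDiff d A)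
        (hcontDiff (-d) (-A)) heq (α + Real.arcsin (-s / 3) / 2) with hcurv | hcurv
    all_goals
      rw [harmonicSupport_add_deriv_deriv, hsin] at hcurv
      linarith
  rcases eq_or_eq_of_forall_eq_or_eq hK.contDiff.continuous (hcontDiff d A).continuous
      (hcontDiff (-d) (-A)).continuous heq hne with h | h
  all_goals exact h ▸ hasModes_harmonicSupport_two ..

theorem hasModes_of_isDeltoidParallel {f : ℝ → ℝ} (hf : IsDeltoidParallel f)
    (hb : IsBoundedBy K f) : HasModes (supportFn K) := by
  obtain ⟨c, d, A, α, hA, rfl⟩ := (isDeltoidParallel_iff f).1 hf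
  have hcont (d : ℝ) := (contDiff_harmonicSupport c d A 3 α 0).continuous
  have heq (φ : ℝ) : supportFn K φ = harmonicSupport c d A 3 α φ ∨
      supportFn K φ = harmonicSupport c (-d) A 3 α φ := by
    have h := hK.eq_or_eq_of_isBoundedBy_harmonicSupport hA.ne' (k := 3) (by norm_num)
      (by simpa using hb) φ
    norm_num at h
    exact h
  obtain h | h : supportFn K = harmonicSupport c d A 3 α ∨
      supportFn K = harmonicSupport c (-d) A 3 α := by
    rcases eq_or_ne d 0 with rfl | hd
    · exact Or.inl (funext fun φ => by simpa using heq φ)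
    · refine eq_or_eq_of_forall_eq_or_eq hK.contDiff.continuous (hcont d) (hcont (-d)) heq
        fun φ hφ => hd ?_
      rw [harmonicSupport, harmonicSupport] at hφ
      linarith
  all_goals exact h ▸ hasModes_harmonicSupport_three ..

theorem hasModes_of_type (h : IsDiskOrAstroidType K ∨ IsDeltoidType K ∨ IsMinkowskiSumType K) :
    HasModes (supportFn K) := by
  rcases h with (⟨c, r, hr, rfl⟩ | ⟨f, hf, hb⟩) | ⟨f, hf, hb⟩ | h
  · exact IsDiskSupport.hasModes ⟨c, r, hr, fun _ => rfl⟩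
  · exact hK.hasModes_of_isAstroidParallel hf hb
  · exact hK.hasModes_of_isDeltoidParallel hf hb
  · exact h.hasModes

theorem eq_closedBall_of_supportFn_eq {c : Plane} {r : ℝ} (hr : 0 ≤ r)
    (h : ∀ φ, supportFn K φ = inner ℝ c (normalVec φ) + r) : K = Metric.closedBall c r :=
  eq_of_supportFn_eq hK.isCompact hK.convex hK.nonempty (isCompact_closedBall c r)
    (convex_closedBall c r) ⟨c, Metric.mem_closedBall_self hr⟩
    (funext fun φ => (h φ).trans (supportFn_closedBall c hr φ).symm)

theorem isDiskOrAstroidType_of_supportFn_eq {c : Plane} {d A α : ℝ} (hA : 0 ≤ A)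
    (h : supportFn K = harmonicSupport c d A 2 α) : IsDiskOrAstroidType K := by
  rcases hA.eq_or_lt with rfl | hA
  · have hd : 0 < d := by
      simpa only [h, harmonicSupport_add_deriv_deriv, zero_mul, add_zero] using hK.curvature_pos 0
    refine Or.inl ⟨c, d, hd, hK.eq_closedBall_of_supportFn_eq hd.le fun φ => ?_⟩
    rw [h, harmonicSupport, zero_mul, add_zero]
  · exact Or.inr ⟨_, (isAstroidParallel_iff _).2 ⟨c, d, A, α, hA, h⟩, hK.frontier_eq⟩

theorem type_of_hasModes (h : HasModes (supportFn K)) :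
    IsDiskOrAstroidType K ∨ IsDeltoidType K ∨ IsMinkowskiSumType K := by
  obtain ⟨c, d, A, α, B, β, hA, hB, h⟩ := h.exists_eq_harmonicSupport_add
  rcases hB.eq_or_lt with rfl | hB
  · refine Or.inl (hK.isDiskOrAstroidType_of_supportFn_eq hA (c := c) (d := d) (α := α) ?_)
    funext φ
    rw [h, harmonicSupport, harmonicSupport, inner_zero_left]
    ring
  rcases hA.eq_or_lt with rfl | hA
  · refine Or.inr (Or.inl ⟨_, (isDeltoidParallel_iff _).2 ⟨c, d, B, β, hB, ?_⟩, hK.frontier_eq⟩)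
    funext φ
    rw [h, harmonicSupport, harmonicSupport, harmonicSupport, inner_zero_left]
    ring
  · refine Or.inr (Or.inr ⟨2, ![harmonicSupport c d A 2 α, harmonicSupport 0 0 B 3 β], le_rfl,
      Fin.forall_fin_two.2 ⟨?_, ?_⟩, fun φ => by rw [h, Fin.sum_univ_two]; rfl⟩)
    · exact Or.inr (Or.inl ((isAstroidParallel_iff _).2 ⟨c, d, A, α, hA, rfl⟩))
    · exact Or.inr (Or.inr ((isDeltoidParallel_iff _).2 ⟨0, 0, B, β, hB, rfl⟩))

end IsStrictlyConvexC2

end VisualAngleDeficit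

theorem mainTheorem2 (K : Set VisualAngleDeficit.Plane)
    (hK : VisualAngleDeficit.IsStrictlyConvexC2 K) :
    IntegrableOn (VisualAngleDeficit.visualIntegrand K) Kᶜ ∧
    (VisualAngleDeficit.EqualityHolds K ↔
      (VisualAngleDeficit.IsDiskOrAstroidType K ∨ VisualAngleDeficit.IsDeltoidType K ∨
        VisualAngleDeficit.IsMinkowskiSumType K)) ∧
    (VisualAngleDeficit.EqualityHolds K ↔
      VisualAngleDeficit.HasOnlyModesZeroTwoThree K) :=
  ⟨hK.integrableOn_visualIntegrand,
    hK.equalityHolds_iff_hasModes.trans ⟨hK.type_of_hasModes, hK.hasModes_of_type⟩,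
    hK.equalityHolds_iff_hasModes.trans hK.hasOnlyModesZeroTwoThree_iff.symm⟩
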